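/- **Setting.** Let $\{Z_t\}$ be the Markov chain $Z_t=(\bar Z_t,\tilde Z_t)$ on $\mathsf Z=\{z_{ij}=(\bar z_i,\tilde z_j):1\le i\le N,\ 1\le j\le M\}$, where $\bar Z_t$ and $\tilde Z_t$ are independent Markov chains with transition matrices $\bar P=(\bar p_{i\ell})$ and $\tilde P=(\tilde p_{jk})$, so that $Z_t$ has transition matrix $P=\bar P\otimes\tilde P$. Let $\epsilon_t$ be i.i.d. innovations with law $\pi$, and let $\beta,R,Y\ge 0$ be measurable functions of $(z,\hat z,\hat\epsilon)$ (discount factor, gross return, income). Write $\hat\beta=\beta(z,\hat Z,\hat\epsilon)$, and similarly $\hat R,\hat Y$, and $\mathbb E_z f(\hat Z,\hat\epsilon)=\sum_{\hat z}P(z,\hat z)\int f(\hat z,e)\,\pi(de)$. Risk aversion is $\gamma(z_{ij})=\gamma_i$ with $0<\gamma_1<\dots<\gamma_N$, utility is $u(c,z)=c^{1-\gamma(z)}/(1-\gamma(z))$ if $\gamma(z)\ne1$ and $u(c,z)=\log c$ if $\gamma(z)=1$, and $u'=\partial u/\partial c$, with $u'(0,z)=\infty$. Throughout $0\cdot\infty=0$,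 and $r(A)$ denotes the spectral radius of a real square matrix $A$. Assume that $\mathbb E_z u'(\hat Y,\hat Z)<\infty$ and $\mathbb E_z\hat\beta\hat R\,u'(\hat Y,\hat Z)<\infty$ for all $z\in\mathsf Z$, and that the matrix $K(1)$ with entries $P(z,\hat z)\int\beta(z,\hat z,e)R(z,\hat z,e)\,\pi(de)$ has finite entries and $r(K(1))<1$. Let $\mathcal C$ be the set of continuous functions $c:(0,\infty)\times\mathsf Z\to(0,\infty)$ that are (weakly) increasing in $w$, satisfy $0<c(w,z)\le w$, and have $\sup_{w>0,\,z}|u'(c(w,z),z)-u'(w,z)|<\infty$. The optimal consumption function $c^*$ is the fixed point in $\mathcal C$ of the time iteration operator $T$, where $Tc(w,z)$ is the $\xi\in(0,w]$ solving $$u'(\xi,z)=\max\left\{\mathbb E_z\,\hat\beta\hat R\,u'\big(c(\hat R(w-\xi)+\hat Y,\hat Z),\hat Z\big),\ u'(w,z)\right\}.$$ For each $i$ let $G_i$ be the $M\times M$ matrix with entries $$G_i(j,k)=\bar p_{ii}\,\tilde p_{jk}\int \beta(z_{ij},z_{ik},e)\,R(z_{ij},z_{ik},e)^{1-\gamma_i}\,\pi(de),$$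 where $\beta R^{1-\gamma_i}$ is understood as $\beta R\cdot R^{-\gamma_i}$, hence as $0$ where $R=0$. For $x\in[1,\infty)^M$, indexed by $\tilde z_1,\dots,\tilde z_M$, let $$(F_ix)(\tilde z_j)=\left(1+(G_ix)(\tilde z_j)^{1/\gamma_i}\right)^{\gamma_i},\qquad j=1,\dots,M.$$ **Theorem.** Let $i\in\{1,\dots,N\}$, and suppose that $\bar p_{ii}=1$, that the entries of $G_i$ are finite, and that $r(G_i)<1$. Then $F_i$ has a unique fixed point $x_i^*=(x_i^*(\tilde z_j))_{j=1}^M$ in $[1,\infty)^M$. Moreover, the optimal consumption function $c^*$ exists and is unique, and $$\lim_{w\to\infty}\frac{c^*(w,z_{ij})}{w}=x_i^*(\tilde z_j)^{-1/\gamma_i}>0\qquad\text{for all } j=1,\dots,M.$$ -/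

import Mathlib

open Filter Topology MeasureTheory
open scoped ENNReal Kronecker

noncomputable section

/-- Constant relative risk aversion utility with coefficient `g`, evaluated at consumption `c`. -/
def crraUtility (g c : ℝ) : ℝ :=
  if g = 1 then Real.log c else c ^ (1 - g) / (1 - g)

/-- Marginal utility `u'(c)` (used for `c > 0`). -/
def marginalUtility (g c : ℝ) : ℝ := deriv (crraUtility g) c

/-- Marginal utility as an extended nonnegative number, with its limit value `u'(0) = ∞`. -/
def marginalUtilityExt (g c : ℝ) : ℝ≥0∞ :=
  if 0 < c then ENNReal.ofReal (marginalUtility g c) else ⊤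

/-- The largest modulus of a complex eigenvalue of a real square matrix. -/
def matrixSpectralRadius {n : Type*} [Fintype n] [DecidableEq n] (A : Matrix n n ℝ) : ℝ≥0∞ :=
  spectralRadius ℂ (A.map (fun a : ℝ => (a : ℂ)))

/-- Primitives of an optimal savings problem with risk aversion shocks.  The exogenous state is a
pair `(i, j)`, standing for `(z̄ᵢ, z̃ⱼ)`; the two components are independent Markov chains with
transition matrices `Pbar` and `Ptilde`, the innovation has law `innov`, and risk aversion depends
on the first component only. -/
structure SavingsModel (N M : ℕ) (E : Type*) [MeasurableSpace E] where
  Pbar : Matrix (Fin N) (Fin N) ℝ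
  Ptilde : Matrix (Fin M) (Fin M) ℝ
  Pbar_stochastic : Pbar ∈ Matrix.rowStochastic ℝ (Fin N)
  Ptilde_stochastic : Ptilde ∈ Matrix.rowStochastic ℝ (Fin M)
  /-- law of the i.i.d. innovations -/
  innov : Measure E
  innov_prob : IsProbabilityMeasure innov
  /-- discount factor `β(z, ẑ, ε̂)` -/
  disc : Fin N × Fin M → Fin N × Fin M → E → ℝ
  /-- gross return `R(z, ẑ, ε̂)` -/
  ret : Fin N × Fin M → Fin N × Fin M → E → ℝ
  /-- non-financial income `Y(z, ẑ, ε̂)` -/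
  inc : Fin N × Fin M → Fin N × Fin M → E → ℝ
  disc_measurable : ∀ z z', Measurable (disc z z')
  ret_measurable : ∀ z z', Measurable (ret z z')
  inc_measurable : ∀ z z', Measurable (inc z z')
  disc_nonneg : ∀ z z' e, 0 ≤ disc z z' e
  ret_nonneg : ∀ z z' e, 0 ≤ ret z z' e
  inc_nonneg : ∀ z z' e, 0 ≤ inc z z' e
  /-- relative risk aversion `γᵢ = γ(z̄ᵢ)` -/
  gam : Fin N → ℝ
  gam_pos : ∀ i, 0 < gam i
  gam_strictMono : StrictMono gam

namespace SavingsModel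

variable {N M : ℕ} {E : Type*} [MeasurableSpace E] (S : SavingsModel N M E)

/-- Transition matrix of the exogenous state: the Kronecker product of the two factors. -/
def trans : Matrix (Fin N × Fin M) (Fin N × Fin M) ℝ := S.Pbar ⊗ₖ S.Ptilde

/-- One-step conditional expectation `𝔼_z f(Ẑ, ε̂)` of a nonnegative function of next period's
state and innovation (with `0 * ∞ = 0`). -/
def condExp (z : Fin N × Fin M) (f : Fin N × Fin M → E → ℝ≥0∞) : ℝ≥0∞ :=
  ∑ z', ENNReal.ofReal (S.trans z z') * ∫⁻ e, f z' e ∂S.innov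

/-- The discounted return `β̂ R̂`. -/
def discRet (z z' : Fin N × Fin M) (e : E) : ℝ≥0∞ :=
  ENNReal.ofReal (S.disc z z' e * S.ret z z' e)

/-- The matrix `K(1)` with entries `P(z, ẑ) ∫ β R dπ`, possibly infinite. -/
def KExt : Matrix (Fin N × Fin M) (Fin N × Fin M) ℝ≥0∞ := fun z z' =>
  ENNReal.ofReal (S.trans z z') * ∫⁻ e, S.discRet z z' e ∂S.innov

/-- The standing assumptions: the two expectations of marginal utility of income are finite, and
`K(1)` is a (finite) real matrix with spectral radius below one. -/
structure StandingAssumptions : Prop where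
  income_finite : ∀ z,
    S.condExp z (fun z' e => marginalUtilityExt (S.gam z'.1) (S.inc z z' e)) < ⊤
  disc_income_finite : ∀ z,
    S.condExp z (fun z' e =>
      S.discRet z z' e * marginalUtilityExt (S.gam z'.1) (S.inc z z' e)) < ⊤
  K_finite : ∀ z z', S.KExt z z' < ⊤
  K_radius : matrixSpectralRadius (S.KExt.map ENNReal.toReal) < 1

/-- The class `𝒞` of candidate policies `c(w, z)`.  Only the values at wealth `w > 0` matter. -/
structure IsCandidate (c : ℝ → Fin N × Fin M → ℝ) : Prop where
  continuousOn : ∀ z, ContinuousOn (fun w => c w z) (Set.Ioi 0)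
  monotoneOn : ∀ z, MonotoneOn (fun w => c w z) (Set.Ioi 0)
  pos : ∀ w z, 0 < w → 0 < c w z
  le : ∀ w z, 0 < w → c w z ≤ w
  bounded : ∃ B : ℝ, ∀ w z, 0 < w →
    |marginalUtility (S.gam z.1) (c w z) - marginalUtility (S.gam z.1) w| ≤ B

/-- `ξ` is a value at `(w, z)` of the image of `c` under the time iteration operator: `ξ ∈ (0, w]`
and `u'(ξ, z) = max {𝔼_z β̂ R̂ u'(c(R̂ (w - ξ) + Ŷ, Ẑ), Ẑ), u'(w, z)}`. -/
def IsTimeIterate (c : ℝ → Fin N × Fin M → ℝ) (w : ℝ) (z : Fin N × Fin M) (ξ : ℝ) : Prop :=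
  0 < ξ ∧ ξ ≤ w ∧
    marginalUtilityExt (S.gam z.1) ξ =
      max
        (S.condExp z (fun z' e => S.discRet z z' e *
          marginalUtilityExt (S.gam z'.1) (c (S.ret z z' e * (w - ξ) + S.inc z z' e) z')))
        (marginalUtilityExt (S.gam z.1) w)

/-- `c` is an optimal consumption function: a fixed point in `𝒞` of the time iteration operator. -/
def IsOptimalConsumption (c : ℝ → Fin N × Fin M → ℝ) : Prop :=
  S.IsCandidate c ∧ ∀ w z, 0 < w → S.IsTimeIterate c w z (c w z)

/-- `Qᵢ(j, k) = 𝔼 β R^(1 - γᵢ)` at the transition from `(i, j)` to `(i, k)`, possibly infinite.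
Here `β R^(1 - γᵢ)` means `β R * R^(-γᵢ)` and is zero where `R = 0`. -/
def QExt (i : Fin N) : Matrix (Fin M) (Fin M) ℝ≥0∞ := fun j k =>
  ∫⁻ e, (if S.ret (i, j) (i, k) e = 0 then 0 else
    ENNReal.ofReal (S.disc (i, j) (i, k) e * S.ret (i, j) (i, k) e ^ (1 - S.gam i))) ∂S.innov

/-- `Gᵢ = p̄ᵢᵢ (P̃ ∘ Qᵢ)` with the entrywise product, possibly infinite (with `0 * ∞ = 0`). -/
def GExt (i : Fin N) : Matrix (Fin M) (Fin M) ℝ≥0∞ := fun j k =>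
  ENNReal.ofReal (S.Pbar i i) * (ENNReal.ofReal (S.Ptilde j k) * S.QExt i j k)

/-- `Gᵢ` as a real matrix; meaningful when the entries of `GExt` are finite. -/
def G (i : Fin N) : Matrix (Fin M) (Fin M) ℝ := (S.GExt i).map ENNReal.toReal

/-- The map `x ↦ (1 + (Gᵢ x)^(1 / γᵢ))^γᵢ`. -/
def F (i : Fin N) (x : Fin M → ℝ) : Fin M → ℝ := fun j =>
  (1 + ((S.G i).mulVec x j) ^ (1 / S.gam i)) ^ S.gam i

end SavingsModel

end

/-! Since `S.Pbar i i = 1`, risk aversion stays at `γ = γᵢ` forever once the first component is `i`.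
With constant `γ`, marginal utility is multiplicative, so when income is neglected the Euler
equation is homogeneous in wealth. A family of rays `c = x ^ (-1/γ) * w` solves it exactly when `x ^
(1/γ) = 1 + (G x) ^ (1/γ)`, that is, when `F x = x`. Such an `x` exists because `r(G) < 1`, and it
is unique by the comparison principle `le_of_sub_super_solution`.

Time iteration is monotone, and it preserves the policies lying above these rays, because income
only lowers future marginal utility (`IsTimeIterate.linear_le`). The least admissible policy above
its own time iterate is therefore an optimal policy above the rays
(`Admissible.exists_fixed_point`). It is the only optimal policy: the vector of largest gaps in
marginal utility between two of them satisfies `ρ ≤ K(1) ρ`, and `r(K(1)) < 1`.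

Lying above the rays gives `limsup w / c ≤ x ^ (1/γ)`. Conversely, income is negligible at large
savings, so the Euler inequality shows that the lower limits `ℓ` of `w / c` satisfy `ℓ ≥ 1 + (G ℓ ^
γ) ^ (1/γ)` (`Admissible.eventually_le_div`). Thus `ℓ ^ γ` is a supersolution, comparison gives `x ≤
ℓ ^ γ`, and the two bounds meet. -/

/-! ### Nonnegative matrices of spectral radius below one -/

section NonnegativeMatrices

theorem Matrix.mulVec_le_mulVec {m n : Type*} [Fintype n] {A : Matrix m n ℝ} (hA : ∀ i j, 0 ≤ A i j)
    {v w : n → ℝ} (hvw : ∀ j, v j ≤ w j) (i : m) : A.mulVec v i ≤ A.mulVec w i :=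
  Finset.sum_le_sum fun j _ => mul_le_mul_of_nonneg_left (hvw j) (hA i j)

theorem Matrix.mulVec_apply_nonneg {m n : Type*} [Fintype n] {A : Matrix m n ℝ} (hA : ∀ i j, 0 ≤ A i j)
    {v : n → ℝ} (hv : ∀ j, 0 ≤ v j) (i : m) : 0 ≤ A.mulVec v i :=
  Finset.sum_nonneg fun j _ => mul_nonneg (hA i j) (hv j)

/-- Comparison of a subsolution and a supersolution of `x ^ (1 / g) = 1 + (A x) ^ (1 / g)`. -/
theorem le_of_sub_super_solution {n : Type*} [Fintype n] {A : Matrix n n ℝ} (hA : ∀ i j, 0 ≤ A i j) {g : ℝ} (hg : 0 < g)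
    {x y : n → ℝ} (hx : ∀ i, 0 ≤ x i) (hy : ∀ i, 0 < y i)
    (hsub : ∀ i, x i ^ (1 / g) ≤ 1 + A.mulVec x i ^ (1 / g))
    (hsup : ∀ i, 1 + A.mulVec y i ^ (1 / g) ≤ y i ^ (1 / g)) (i : n) : x i ≤ y i := by
  have : Nonempty n := ⟨i⟩
  -- At an index where the ratio `t = x / y` is maximal, scaling the supersolution inequality by `t
  -- ^ (1 / g)` turns its constant 1 into `t ^ (1 / g)`. If `t > 1` this contradicts the subsolution
  -- inequality, whose constant is only 1.
  obtain ⟨m, hm⟩ := Finite.exists_max (fun i => x i / y i)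
  set t := x m / y m with ht
  have ht0 : 0 ≤ t := div_nonneg (hx m) (hy m).le
  have hxt : ∀ i, x i ≤ t * y i := fun i => (div_le_iff₀ (hy i)).1 (hm i)
  have hg' : 0 < 1 / g := by positivity
  have hle : t ≤ 1 := by
    by_contra! h1
    have ht1 : 1 < t ^ (1 / g) := Real.one_lt_rpow h1 hg'
    have hAx : A.mulVec x m ≤ t * A.mulVec y m := by
      have := Matrix.mulVec_le_mulVec hA (v := x) (w := t • y) hxt m
      simpa [Matrix.mulVec_smul] using this
    have h2 : A.mulVec x m ^ (1 / g) ≤ t ^ (1 / g) * A.mulVec y m ^ (1 / g) := by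
      rw [← Real.mul_rpow ht0 (Matrix.mulVec_apply_nonneg hA (fun i => (hy i).le) m)]
      exact Real.rpow_le_rpow (Matrix.mulVec_apply_nonneg hA hx m) hAx hg'.le
    have h3 : x m ^ (1 / g) = t ^ (1 / g) * y m ^ (1 / g) := by
      rw [← Real.mul_rpow ht0 (hy m).le, ht, div_mul_cancel₀ _ (hy m).ne']
    have h4 := hsub m
    have h5 := mul_le_mul_of_nonneg_left (hsup m) (zero_le_one.trans ht1.le)
    linarith
  calc x i ≤ t * y i := hxt i
    _ ≤ 1 * y i := mul_le_mul_of_nonneg_right hle (hy i).le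
    _ = y i := one_mul _

variable {n : Type*} [Fintype n] [DecidableEq n]

attribute [local instance] Matrix.linftyOpNormedRing Matrix.linftyOpNormedAlgebra in
/-- Gelfand's formula: powers of a complex matrix of spectral radius below one vanish. -/
theorem Matrix.tendsto_pow_zero_of_spectralRadius_lt_one {B : Matrix n n ℂ}
    (h : spectralRadius ℂ B < 1) (i j : n) :
    Tendsto (fun k : ℕ => (B ^ k) i j) atTop (𝓝 0) := by
  obtain ⟨r, hr, hr1⟩ := exists_between h
  have hev : ∀ᶠ k : ℕ in atTop, ‖B ^ k‖ ≤ r.toReal ^ k := by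
    have := (spectrum.pow_nnnorm_pow_one_div_tendsto_nhds_spectralRadius B).eventually_lt_const hr
    filter_upwards [this, eventually_gt_atTop 0] with k hk hk0
    have hk' : ((‖B ^ k‖₊ : ℝ≥0∞)) ≤ r ^ k := by
      have h1 := ENNReal.rpow_le_rpow hk.le (Nat.cast_nonneg (α := ℝ) k)
      rwa [← ENNReal.rpow_mul, one_div_mul_cancel (by positivity), ENNReal.rpow_one,
        ENNReal.rpow_natCast] at h1
    have := ENNReal.toReal_mono (ENNReal.pow_ne_top hr1.ne_top) hk'
    simpa [ENNReal.toReal_pow] using this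
  have hr0 : r.toReal < 1 := by
    have := (ENNReal.toReal_lt_toReal hr1.ne_top ENNReal.one_ne_top).2 hr1
    simpa using this
  have hnorm : Tendsto (fun k : ℕ => ‖B ^ k‖) atTop (𝓝 0) :=
    squeeze_zero' (Eventually.of_forall fun _ => norm_nonneg _) hev
      (tendsto_pow_atTop_nhds_zero_of_lt_one ENNReal.toReal_nonneg hr0)
  refine squeeze_zero_norm (fun k => ?_) hnorm
  have h1 : ‖(B ^ k) i j‖₊ ≤ ‖B ^ k‖₊ := by
    rw [Matrix.linfty_opNNNorm_def]
    exact (Finset.single_le_sum (f := fun j => ‖(B ^ k) i j‖₊) (fun _ _ => zero_le)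
      (Finset.mem_univ j)).trans
      (Finset.le_sup (f := fun i => ∑ j, ‖(B ^ k) i j‖₊) (Finset.mem_univ i))
  exact h1

theorem tendsto_pow_zero_of_matrixSpectralRadius_lt_one {A : Matrix n n ℝ}
    (h : matrixSpectralRadius A < 1) (i j : n) :
    Tendsto (fun k : ℕ => (A ^ k) i j) atTop (𝓝 0) := by
  have h1 := Matrix.tendsto_pow_zero_of_spectralRadius_lt_one h i j
  have h2 : ∀ k : ℕ, ((A.map (fun a : ℝ => (a : ℂ))) ^ k) i j = (((A ^ k) i j : ℝ) : ℂ) := by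
    intro k
    have := congrFun (congrFun (map_pow (Complex.ofRealHom.mapMatrix) A k) i) j
    exact this.symm
  simp only [h2] at h1
  have h3 := (Complex.continuous_re.tendsto 0).comp h1
  simpa [Function.comp_def] using h3

theorem tendsto_pow_mulVec_zero {A : Matrix n n ℝ} (h : matrixSpectralRadius A < 1) (v : n → ℝ)
    (i : n) : Tendsto (fun k : ℕ => (A ^ k).mulVec v i) atTop (𝓝 0) := by
  have : Tendsto (fun k : ℕ => ∑ j, (A ^ k) i j * v j) atTop (𝓝 (∑ j : n, 0 * v j)) :=
    tendsto_finsetSum _ fun j _ =>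
      (tendsto_pow_zero_of_matrixSpectralRadius_lt_one h i j).mul_const _
  simpa [Matrix.mulVec, dotProduct] using this

/-- A vector dominated by its image under a nonnegative matrix of spectral radius below one is
nonpositive. -/
theorem nonpos_of_le_mulVec {A : Matrix n n ℝ} (hA : ∀ i j, 0 ≤ A i j)
    (h : matrixSpectralRadius A < 1) {v : n → ℝ} (hv : ∀ i, v i ≤ A.mulVec v i) (i : n) :
    v i ≤ 0 := by
  have hk : ∀ (k : ℕ) (i : n), v i ≤ (A ^ k).mulVec v i := by
    intro k
    induction k with
    | zero => simp
    | succ k ih =>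
      intro i
      rw [pow_succ', ← Matrix.mulVec_mulVec]
      exact (hv i).trans (Matrix.mulVec_le_mulVec hA ih i)
  exact ge_of_tendsto' (tendsto_pow_mulVec_zero h v i) fun k => hk k i

/-- The equation `b = a + A b` has a nonnegative solution when `a` and `A` are nonnegative and `A`
has spectral radius below one. -/
theorem exists_nonneg_eq_add_mulVec {A : Matrix n n ℝ} (hA : ∀ i j, 0 ≤ A i j)
    (h : matrixSpectralRadius A < 1) {a : n → ℝ} (ha : ∀ i, 0 ≤ a i) :
    ∃ b : n → ℝ, (∀ i, 0 ≤ b i) ∧ ∀ i, b i = a i + A.mulVec b i := by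
  -- A difference `d` of two vectors with the same image satisfies `d = A d`, so both `d` and `-d`
  -- are nonpositive.
  have hinj : Function.Injective (1 - A).mulVec := by
    intro v w hvw
    have hd : ∀ i, (v - w) i = A.mulVec (v - w) i := by
      intro i
      have := congrFun hvw i
      simp only [Matrix.sub_mulVec, Matrix.one_mulVec, Pi.sub_apply] at this
      simp only [Matrix.mulVec_sub, Pi.sub_apply]
      linarith
    have h1 := nonpos_of_le_mulVec hA h (fun i => (hd i).le)
    have h2 : ∀ i, (-(v - w)) i ≤ 0 := nonpos_of_le_mulVec hA h fun i => by
      rw [Matrix.mulVec_neg, Pi.neg_apply, Pi.neg_apply, ← hd i]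
    funext i
    have := h1 i
    have := h2 i
    simp only [Pi.sub_apply, Pi.neg_apply] at *
    linarith
  obtain ⟨b, hb⟩ := (Matrix.mulVec_surjective_iff_isUnit.2
    (Matrix.mulVec_injective_iff_isUnit.1 hinj)) a
  have hb' : ∀ i, b i = a i + A.mulVec b i := by
    intro i
    have := congrFun hb i
    simp only [Matrix.sub_mulVec, Matrix.one_mulVec, Pi.sub_apply] at this
    linarith
  refine ⟨b, fun i => ?_, hb'⟩
  have := nonpos_of_le_mulVec hA h (v := -b) (fun i => by
    rw [Matrix.mulVec_neg, Pi.neg_apply, Pi.neg_apply]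
    linarith [hb' i, ha i]) i
  simp only [Pi.neg_apply] at this
  linarith

/-- The solution of `p = 1 + A p` satisfies `A p = p - 1 ≤ q p` with `q = 1 - 1 / C < 1`, where `C`
bounds `p`. A large multiple `t p` is then a supersolution; `t ^ (1 / g) = 1 / (1 - q ^ (1 / g))` is
the scale at which the contraction gained from `q` absorbs the constant 1. -/
theorem exists_super_solution {A : Matrix n n ℝ} (hA : ∀ i j, 0 ≤ A i j)
    (h : matrixSpectralRadius A < 1) {g : ℝ} (hg : 0 < g) :
    ∃ y : n → ℝ, (∀ i, 1 ≤ y i) ∧ ∀ i, (1 + A.mulVec y i ^ (1 / g)) ^ g ≤ y i := by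
  obtain ⟨p, hp0, hp⟩ := exists_nonneg_eq_add_mulVec hA h (a := fun _ => 1) (fun _ => zero_le_one)
  have hp1 : ∀ i, 1 ≤ p i := fun i => by
    rw [hp i]; linarith [Matrix.mulVec_apply_nonneg hA hp0 i]
  have hg' : 0 < 1 / g := by positivity
  set C := 1 + ∑ i, p i with hC
  have hpC : ∀ i, p i ≤ C := fun i => by
    have := Finset.single_le_sum (f := p) (fun i _ => hp0 i) (Finset.mem_univ i)
    linarith
  have hC1 : 1 ≤ C := by
    have := Finset.sum_nonneg (s := Finset.univ) (f := p) (fun i _ => hp0 i)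
    linarith
  have hC0 : 0 < C := by linarith
  set q := 1 - 1 / C with hq
  have hq0 : 0 ≤ q := by
    rw [hq, sub_nonneg, div_le_one hC0]; exact hC1
  have hq1 : q < 1 := by rw [hq]; linarith [one_div_pos.2 hC0]
  have hAp : ∀ i, A.mulVec p i ≤ q * p i := fun i => by
    have h1 : p i / C ≤ 1 := (div_le_one hC0).2 (hpC i)
    have h2 : q * p i = p i - p i / C := by rw [hq]; ring
    rw [h2]
    linarith [hp i]
  set s := 1 - q ^ (1 / g) with hs
  have hs0 : 0 < s := by
    rw [hs, sub_pos]; exact Real.rpow_lt_one hq0 hq1 hg'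
  have hs1 : s ≤ 1 := by rw [hs]; linarith [Real.rpow_nonneg hq0 (1 / g)]
  have hsinv : 1 ≤ s⁻¹ := (one_le_inv₀ hs0).2 hs1
  set t := (s⁻¹) ^ g with ht
  have ht1 : 1 ≤ t := Real.one_le_rpow hsinv hg.le
  have ht0 : 0 ≤ t := zero_le_one.trans ht1
  have htg : t ^ (1 / g) = s⁻¹ := by
    rw [ht, ← Real.rpow_mul (by positivity), mul_one_div_cancel hg.ne', Real.rpow_one]
  have htp : ∀ i, 1 ≤ t * p i := fun i => one_le_mul_of_one_le_of_one_le ht1 (hp1 i)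
  refine ⟨fun i => t * p i, htp, fun i => ?_⟩
  have h1 : A.mulVec (fun i => t * p i) i = t * A.mulVec p i := by
    have : (fun i => t * p i) = t • p := rfl
    rw [this, Matrix.mulVec_smul]; rfl
  have hA0 := Matrix.mulVec_apply_nonneg hA hp0 i
  have h2 : (t * A.mulVec p i) ^ (1 / g) ≤ s⁻¹ * (q ^ (1 / g) * p i ^ (1 / g)) := by
    rw [Real.mul_rpow ht0 hA0, htg, ← Real.mul_rpow hq0 (hp0 i)]
    exact mul_le_mul_of_nonneg_left (Real.rpow_le_rpow hA0 (hAp i) hg'.le) (by positivity)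
  have h3 : 1 ≤ p i ^ (1 / g) := Real.one_le_rpow (hp1 i) hg'.le
  have h4 : 1 + (t * A.mulVec p i) ^ (1 / g) ≤ s⁻¹ * p i ^ (1 / g) := by
    have h5 : s⁻¹ * (q ^ (1 / g) * p i ^ (1 / g)) = s⁻¹ * p i ^ (1 / g) - p i ^ (1 / g) := by
      have : q ^ (1 / g) = 1 - s := by rw [hs]; ring
      rw [this]; field_simp
    linarith
  rw [h1]
  calc (1 + (t * A.mulVec p i) ^ (1 / g)) ^ g ≤ (s⁻¹ * p i ^ (1 / g)) ^ g := by
        refine Real.rpow_le_rpow ?_ h4 hg.le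
        have := Real.rpow_nonneg (mul_nonneg ht0 hA0) (1 / g)
        linarith
    _ = t * p i := by
        rw [Real.mul_rpow (by positivity) (by linarith), ← Real.rpow_mul (hp0 i),
          one_div_mul_cancel hg.ne', Real.rpow_one]

/-- The least element of the set of supersolutions is a fixed point. -/
theorem exists_fixed_point_of_spectralRadius_lt_one {A : Matrix n n ℝ} (hA : ∀ i j, 0 ≤ A i j)
    (h : matrixSpectralRadius A < 1) {g : ℝ} (hg : 0 < g) :
    ∃ x : n → ℝ, (∀ i, 1 ≤ x i) ∧ ∀ i, (1 + A.mulVec x i ^ (1 / g)) ^ g = x i := by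
  have hg' : 0 < 1 / g := by positivity
  let Φ : (n → ℝ) → n → ℝ := fun x i => (1 + A.mulVec x i ^ (1 / g)) ^ g
  have hΦ1 : ∀ x : n → ℝ, (∀ i, 1 ≤ x i) → ∀ i, 1 ≤ Φ x i := fun x hx i => by
    refine Real.one_le_rpow ?_ hg.le
    have := Real.rpow_nonneg
      (Matrix.mulVec_apply_nonneg hA (fun i => zero_le_one.trans (hx i)) i) (1 / g)
    linarith
  have hΦmono : ∀ x y : n → ℝ, (∀ i, 1 ≤ x i) → (∀ i, x i ≤ y i) → ∀ i, Φ x i ≤ Φ y i := by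
    intro x y hx hxy i
    have h0 := Matrix.mulVec_apply_nonneg hA (fun i => zero_le_one.trans (hx i)) i
    refine Real.rpow_le_rpow (by linarith [Real.rpow_nonneg h0 (1 / g)]) ?_ hg.le
    have := Real.rpow_le_rpow h0 (Matrix.mulVec_le_mulVec hA hxy i) hg'.le
    linarith
  let U : Set (n → ℝ) := {y | (∀ i, 1 ≤ y i) ∧ ∀ i, Φ y i ≤ y i}
  obtain ⟨y₀, hy₀⟩ : U.Nonempty := exists_super_solution hA h hg
  let x : n → ℝ := fun i => ⨅ y : U, y.1 i
  have : Nonempty U := ⟨⟨y₀, hy₀⟩⟩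
  have hx1 : ∀ i, 1 ≤ x i := fun i => le_ciInf fun y => y.2.1 i
  have hxle : ∀ y ∈ U, ∀ i, x i ≤ y i := fun y hy i =>
    ciInf_le (f := fun y : U => y.1 i) ⟨1, by rintro _ ⟨y, rfl⟩; exact y.2.1 i⟩ ⟨y, hy⟩
  have hΦx : ∀ i, Φ x i ≤ x i := fun i => le_ciInf fun y =>
    (hΦmono x y.1 hx1 (hxle y.1 y.2) i).trans (y.2.2 i)
  -- By monotonicity `Φ x` is again a supersolution, so the infimum `x` lies below it.
  exact ⟨x, hx1, fun i => le_antisymm (hΦx i)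
    (hxle (Φ x) ⟨hΦ1 x hx1, hΦmono (Φ x) x (hΦ1 x hx1) hΦx⟩ i)⟩

end NonnegativeMatrices

/-! ### Marginal utility as an extended nonnegative number -/

theorem marginalUtility_eq_rpow (g c : ℝ) : marginalUtility g c = c ^ (-g) := by
  unfold marginalUtility
  by_cases hg : g = 1
  · have : crraUtility g = Real.log := by funext x; simp [crraUtility, hg]
    rw [this, Real.deriv_log, hg, Real.rpow_neg_one]
  · have : crraUtility g = fun x => x ^ (1 - g) / (1 - g) := by funext x; simp [crraUtility, hg]
    have hg' : 1 - g ≠ 0 := sub_ne_zero.2 (Ne.symm hg)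
    rw [this, deriv_div_const, Real.deriv_rpow_const, mul_div_cancel_left₀ _ hg']
    congr 1
    ring

/-- The convention at `c ≤ 0` is already part of the extended power, since `0 ^ (-g) = ∞`.
Continuity, monotonicity and multiplicativity then need no case split. -/
theorem marginalUtilityExt_eq_rpow {g : ℝ} (hg : 0 < g) (c : ℝ) :
    marginalUtilityExt g c = ENNReal.ofReal c ^ (-g) := by
  unfold marginalUtilityExt
  split_ifs with h
  · rw [marginalUtility_eq_rpow, ENNReal.ofReal_rpow_of_pos h]
  · rw [ENNReal.ofReal_of_nonpos (not_lt.1 h), ENNReal.zero_rpow_of_neg (by linarith)]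

theorem marginalUtilityExt_of_pos {g c : ℝ} (hc : 0 < c) :
    marginalUtilityExt g c = ENNReal.ofReal (c ^ (-g)) := by
  rw [marginalUtilityExt, if_pos hc, marginalUtility_eq_rpow]

theorem marginalUtilityExt_of_nonpos {g c : ℝ} (hc : c ≤ 0) : marginalUtilityExt g c = ⊤ :=
  if_neg (not_lt.2 hc)

theorem marginalUtilityExt_lt_top_iff {g c : ℝ} : marginalUtilityExt g c < ⊤ ↔ 0 < c := by
  unfold marginalUtilityExt
  split_ifs with h <;> simp [h]

theorem continuous_marginalUtilityExt {g : ℝ} (hg : 0 < g) :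
    Continuous (marginalUtilityExt g) := by
  rw [funext (marginalUtilityExt_eq_rpow hg)]
  exact ENNReal.continuous_rpow_const.comp ENNReal.continuous_ofReal

theorem antitone_marginalUtilityExt {g : ℝ} (hg : 0 < g) : Antitone (marginalUtilityExt g) := by
  intro a b hab
  rw [marginalUtilityExt_eq_rpow hg, marginalUtilityExt_eq_rpow hg, ENNReal.rpow_neg,
    ENNReal.rpow_neg, ENNReal.inv_le_inv]
  exact ENNReal.rpow_le_rpow (ENNReal.ofReal_le_ofReal hab) hg.le

theorem marginalUtilityExt_lt_of_lt {g a b : ℝ} (hg : 0 < g) (ha : 0 < a) (hab : a < b) :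
    marginalUtilityExt g b < marginalUtilityExt g a := by
  rw [marginalUtilityExt_of_pos ha, marginalUtilityExt_of_pos (ha.trans hab),
    ENNReal.ofReal_lt_ofReal_iff (Real.rpow_pos_of_pos ha _)]
  exact Real.rpow_lt_rpow_of_neg ha hab (by linarith)

theorem marginalUtilityExt_mul {g : ℝ} (hg : 0 < g) {a : ℝ} (ha : 0 ≤ a) (b : ℝ) :
    marginalUtilityExt g (a * b) = marginalUtilityExt g a * marginalUtilityExt g b := by
  rw [marginalUtilityExt_eq_rpow hg, marginalUtilityExt_eq_rpow hg, marginalUtilityExt_eq_rpow hg,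
    ENNReal.ofReal_mul ha, ENNReal.mul_rpow_of_ne_top ENNReal.ofReal_ne_top ENNReal.ofReal_ne_top]

theorem ENNReal.ofReal_mulVec_map_toReal {m n : Type*} [Fintype n] {A : Matrix m n ℝ≥0∞}
    (hA : ∀ i j, A i j < ⊤) {b : n → ℝ} (hb : ∀ j, 0 ≤ b j) (i : m) :
    ENNReal.ofReal ((A.map ENNReal.toReal).mulVec b i) = ∑ j, A i j * ENNReal.ofReal (b j) := by
  have : (A.map ENNReal.toReal).mulVec b i = ∑ j, (A i j).toReal * b j := rfl
  rw [this, ENNReal.ofReal_sum_of_nonneg fun j _ => mul_nonneg ENNReal.toReal_nonneg (hb j)]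
  refine Finset.sum_congr rfl fun j _ => ?_
  rw [ENNReal.ofReal_mul ENNReal.toReal_nonneg, ENNReal.ofReal_toReal (hA i j).ne]

/-! ### Conditional expectations and the bound on marginal utility -/

namespace SavingsModel

variable {N M : ℕ} {E : Type*} [MeasurableSpace E] (S : SavingsModel N M E)

theorem trans_nonneg (z z' : Fin N × Fin M) : 0 ≤ S.trans z z' :=
  mul_nonneg (S.Pbar_stochastic.1 _ _) (S.Ptilde_stochastic.1 _ _)

theorem measurable_discRet (z z' : Fin N × Fin M) : Measurable (S.discRet z z') :=
  ((S.disc_measurable z z').mul (S.ret_measurable z z')).ennreal_ofReal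

theorem discRet_ne_top (z z' : Fin N × Fin M) (e : E) : S.discRet z z' e ≠ ⊤ :=
  ENNReal.ofReal_ne_top

theorem measurable_marginalUtilityExt_comp (z' : Fin N × Fin M) {f : E → ℝ} (hf : Measurable f) :
    Measurable fun e => marginalUtilityExt (S.gam z'.1) (f e) :=
  (continuous_marginalUtilityExt (S.gam_pos _)).measurable.comp hf

theorem condExp_mono_ae {z : Fin N × Fin M} {f f' : Fin N × Fin M → E → ℝ≥0∞}
    (h : ∀ z', S.trans z z' ≠ 0 → ∀ᵐ e ∂S.innov, f z' e ≤ f' z' e) :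
    S.condExp z f ≤ S.condExp z f' := by
  refine Finset.sum_le_sum fun z' _ => ?_
  by_cases h0 : S.trans z z' = 0
  · simp [h0]
  · exact mul_le_mul_right (lintegral_mono_ae (h z' h0)) _

theorem condExp_mono {z : Fin N × Fin M} {f f' : Fin N × Fin M → E → ℝ≥0∞}
    (h : ∀ z' e, f z' e ≤ f' z' e) : S.condExp z f ≤ S.condExp z f' :=
  S.condExp_mono_ae fun z' _ => Eventually.of_forall (h z')

theorem condExp_add_discRet_mul (z : Fin N × Fin M) (f : Fin N × Fin M → E → ℝ≥0∞)
    (b : Fin N × Fin M → ℝ≥0∞) :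
    S.condExp z (fun z' e => f z' e + S.discRet z z' e * b z') =
      S.condExp z f + ∑ z', S.KExt z z' * b z' := by
  unfold condExp
  rw [← Finset.sum_add_distrib]
  refine Finset.sum_congr rfl fun z' _ => ?_
  rw [lintegral_add_right _ ((S.measurable_discRet z z').mul_const _),
    lintegral_mul_const _ (S.measurable_discRet z z'), mul_add, KExt, mul_assoc]

/-- Income is almost surely positive on every transition of positive probability. -/
theorem StandingAssumptions.ae_inc_pos {S : SavingsModel N M E} (hS : S.StandingAssumptions)
    {z z' : Fin N × Fin M} (h : S.trans z z' ≠ 0) : ∀ᵐ e ∂S.innov, 0 < S.inc z z' e := by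
  have h1 := ENNReal.sum_lt_top.1 (hS.income_finite z) z' (Finset.mem_univ _)
  have h2 : ∫⁻ e, marginalUtilityExt (S.gam z'.1) (S.inc z z' e) ∂S.innov ≠ ⊤ := by
    intro htop
    rw [htop, ENNReal.mul_top] at h1
    · exact h1.ne rfl
    · exact (ENNReal.ofReal_pos.2 (lt_of_le_of_ne (S.trans_nonneg z z') h.symm)).ne'
  filter_upwards [ae_lt_top
    (S.measurable_marginalUtilityExt_comp z' (S.inc_measurable z z')) h2] with e he
  exact marginalUtilityExt_lt_top_iff.1 he

/-- The vector `b` satisfies `b = 𝔼 β̂ R̂ u'(Ŷ) + K(1) b`. -/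
def IsMarginalBound (b : Fin N × Fin M → ℝ) : Prop := ∀ z, ENNReal.ofReal (b z) =
  S.condExp z (fun z' e => S.discRet z z' e *
    (marginalUtilityExt (S.gam z'.1) (S.inc z z' e) + ENNReal.ofReal (b z')))

/-- This is where `r(K(1)) < 1` enters existence: `b` is the total discounted effect of `𝔼 β̂ R̂
u'(Ŷ)`. The estimate `u'(c(w)) ≤ u'(w) + b` reproduces itself under time iteration. -/
theorem StandingAssumptions.exists_isMarginalBound {S : SavingsModel N M E} (hS : S.StandingAssumptions) :
    ∃ b : Fin N × Fin M → ℝ, (∀ z, 0 ≤ b z) ∧ S.IsMarginalBound b := by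
  obtain ⟨b, hb0, hb⟩ := exists_nonneg_eq_add_mulVec (A := S.KExt.map ENNReal.toReal)
    (fun _ _ => ENNReal.toReal_nonneg) hS.K_radius
    (a := fun z => (S.condExp z (fun z' e =>
      S.discRet z z' e * marginalUtilityExt (S.gam z'.1) (S.inc z z' e))).toReal)
    (fun _ => ENNReal.toReal_nonneg)
  refine ⟨b, hb0, fun z => ?_⟩
  simp only [mul_add]
  rw [condExp_add_discRet_mul, ← ENNReal.ofReal_mulVec_map_toReal hS.K_finite hb0,
    ← ENNReal.ofReal_toReal (hS.disc_income_finite z).ne, hb z, ENNReal.ofReal_add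
      ENNReal.toReal_nonneg
      (Matrix.mulVec_apply_nonneg (A := S.KExt.map ENNReal.toReal) (fun _ _ => ENNReal.toReal_nonneg) hb0 z)]

end SavingsModel

/-! ### Time iterates and admissible policies -/

namespace SavingsModel

variable {N M : ℕ} {E : Type*} [MeasurableSpace E] (S : SavingsModel N M E)

/-- The expected discounted marginal utility of the policy `c` after saving `s` in state `z`. -/
noncomputable def eulerTerm (c : ℝ → Fin N × Fin M → ℝ) (z : Fin N × Fin M) (s : ℝ) : ℝ≥0∞ :=
  S.condExp z (fun z' e => S.discRet z z' e *
    marginalUtilityExt (S.gam z'.1) (c (S.ret z z' e * s + S.inc z z' e) z'))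

variable {S} in
theorem IsTimeIterate.eq {c : ℝ → Fin N × Fin M → ℝ} {w ξ : ℝ} {z : Fin N × Fin M}
    (h : S.IsTimeIterate c w z ξ) : marginalUtilityExt (S.gam z.1) ξ =
      max (S.eulerTerm c z (w - ξ)) (marginalUtilityExt (S.gam z.1) w) :=
  h.2.2

variable {S} in
theorem IsTimeIterate.eulerTerm_le {c : ℝ → Fin N × Fin M → ℝ} {w ξ : ℝ} {z : Fin N × Fin M}
    (h : S.IsTimeIterate c w z ξ) :
    S.eulerTerm c z (w - ξ) ≤ marginalUtilityExt (S.gam z.1) ξ :=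
  h.eq ▸ le_max_left _ _

variable {S} in
/-- The Euler equation holds with equality where the borrowing constraint does not bind. -/
theorem IsTimeIterate.eq_eulerTerm {c : ℝ → Fin N × Fin M → ℝ} {w ξ : ℝ} {z : Fin N × Fin M}
    (h : S.IsTimeIterate c w z ξ) (hlt : ξ < w) :
    marginalUtilityExt (S.gam z.1) ξ = S.eulerTerm c z (w - ξ) := by
  have h1 := marginalUtilityExt_lt_of_lt (S.gam_pos z.1) h.1 hlt
  rw [h.eq] at h1 ⊢
  exact max_eq_left (le_of_lt ((lt_max_iff.1 h1).resolve_right (lt_irrefl _)))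

theorem antitone_eulerTerm {c : ℝ → Fin N × Fin M → ℝ} (hc : ∀ z, Monotone fun w => c w z)
    (z : Fin N × Fin M) : Antitone (S.eulerTerm c z) := by
  intro s t hst
  refine S.condExp_mono fun z' e => mul_le_mul_right ?_ _
  refine antitone_marginalUtilityExt (S.gam_pos _) (hc z' ?_)
  have := mul_le_mul_of_nonneg_left hst (S.ret_nonneg z z' e)
  linarith

theorem eulerTerm_le_eulerTerm {c d : ℝ → Fin N × Fin M → ℝ} (h : ∀ w z, d w z ≤ c w z)
    (z : Fin N × Fin M) (s : ℝ) : S.eulerTerm c z s ≤ S.eulerTerm d z s :=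
  S.condExp_mono fun _ _ => mul_le_mul_right (antitone_marginalUtilityExt (S.gam_pos _) (h _ _)) _

variable {S} in
/-- The time iterate is increasing in the policy and in wealth. -/
theorem IsTimeIterate.le_of_le {c d : ℝ → Fin N × Fin M → ℝ} (hc : ∀ z, Monotone fun w => c w z)
    (hdc : ∀ w z, d w z ≤ c w z) {v w ξ η : ℝ} {z : Fin N × Fin M} (hvw : v ≤ w)
    (hη : S.IsTimeIterate d v z η) (hξ : S.IsTimeIterate c w z ξ) : η ≤ ξ := by
  by_contra! hlt
  have h1 := marginalUtilityExt_lt_of_lt (S.gam_pos z.1) hξ.1 hlt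
  rw [hξ.eq, hη.eq] at h1
  refine absurd h1 (not_lt.2 (max_le_max ?_ (antitone_marginalUtilityExt (S.gam_pos _) hvw)))
  exact (S.antitone_eulerTerm hc z (by linarith)).trans (S.eulerTerm_le_eulerTerm hdc z _)

variable {S} in
/-- Savings are increasing in wealth. -/
theorem IsTimeIterate.sub_le_sub {c : ℝ → Fin N × Fin M → ℝ} (hc : ∀ z, Monotone fun w => c w z)
    {v w ξ η : ℝ} {z : Fin N × Fin M} (hvw : v ≤ w)
    (hη : S.IsTimeIterate c v z η) (hξ : S.IsTimeIterate c w z ξ) : v - η ≤ w - ξ := by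
  by_contra! hlt
  have hηv : η < v := by linarith [hξ.2.1]
  have h1 := marginalUtilityExt_lt_of_lt (S.gam_pos z.1) hη.1 (show η < ξ by linarith)
  rw [hη.eq_eulerTerm hηv] at h1
  exact absurd (h1.trans_le (S.antitone_eulerTerm hc z hlt.le)) (not_lt.2 hξ.eulerTerm_le)

/-- Policies that are increasing in wealth, leave savings increasing in wealth, and satisfy
the bounds given by `b` (on marginal utility) and `a` (on consumption in the states `(i, j)`). -/
structure Admissible (b : Fin N × Fin M → ℝ) (i : Fin N) (a : Fin M → ℝ)
    (c : ℝ → Fin N × Fin M → ℝ) : Prop where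
  nonneg : ∀ w z, 0 ≤ c w z
  le_max : ∀ w z, c w z ≤ max w 0
  monotone : ∀ z, Monotone fun w => c w z
  monotone_sub : ∀ z, Monotone fun w => w - c w z
  bound : ∀ w z, marginalUtilityExt (S.gam z.1) (c w z) ≤
    marginalUtilityExt (S.gam z.1) w + ENNReal.ofReal (b z)
  lower : ∀ w j, 0 ≤ w → a j * w ≤ c w (i, j)

namespace Admissible

variable {S} {b : Fin N × Fin M → ℝ} {i : Fin N} {a : Fin M → ℝ} {c : ℝ → Fin N × Fin M → ℝ}

theorem pos (hc : S.Admissible b i a c) {w : ℝ} (hw : 0 < w) (z : Fin N × Fin M) : 0 < c w z := by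
  rw [← marginalUtilityExt_lt_top_iff (g := S.gam z.1)]
  exact (hc.bound w z).trans_lt
    (ENNReal.add_lt_top.2 ⟨marginalUtilityExt_lt_top_iff.2 hw, ENNReal.ofReal_lt_top⟩)

theorem le_self (hc : S.Admissible b i a c) {w : ℝ} (hw : 0 ≤ w) (z : Fin N × Fin M) :
    c w z ≤ w :=
  (hc.le_max w z).trans_eq (max_eq_left hw)

/-- Consumption and savings both increase with wealth, so consumption is 1-Lipschitz. Equicontinuity
of this kind survives infima, whereas continuity alone would not. -/
theorem continuous (hc : S.Admissible b i a c) (z : Fin N × Fin M) :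
    Continuous fun w => c w z := by
  refine (LipschitzWith.of_le_add_mul 1 fun v w => ?_).continuous
  rcases le_total v w with h | h
  · have := hc.monotone z h
    have h2 := dist_nonneg (x := v) (y := w)
    simp only [NNReal.coe_one, one_mul] at *
    linarith
  · have := hc.monotone_sub z h
    rw [Real.dist_eq, abs_of_nonneg (sub_nonneg.2 h)]
    simp only [NNReal.coe_one, one_mul] at *
    linarith

theorem marginalUtilityExt_le (hc : S.Admissible b i a c) {s : ℝ} (hs : 0 ≤ s)
    (z z' : Fin N × Fin M) (e : E) :
    marginalUtilityExt (S.gam z'.1) (c (S.ret z z' e * s + S.inc z z' e) z') ≤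
      marginalUtilityExt (S.gam z'.1) (S.inc z z' e) + ENNReal.ofReal (b z') := by
  refine (hc.bound _ z').trans (add_le_add_left (antitone_marginalUtilityExt (S.gam_pos _) ?_) _)
  linarith [mul_nonneg (S.ret_nonneg z z' e) hs]

theorem eulerTerm_le (hc : S.Admissible b i a c) (hb : S.IsMarginalBound b) {s : ℝ} (hs : 0 ≤ s)
    (z : Fin N × Fin M) :
    S.eulerTerm c z s ≤ ENNReal.ofReal (b z) := by
  rw [hb z]
  exact S.condExp_mono fun z' e => mul_le_mul_right (hc.marginalUtilityExt_le hs z z' e) _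

theorem continuousOn_eulerTerm (hc : S.Admissible b i a c) (hb : S.IsMarginalBound b)
    (z : Fin N × Fin M) :
    ContinuousOn (S.eulerTerm c z) (Set.Ici 0) := by
  intro s _
  unfold ContinuousWithinAt eulerTerm condExp
  refine tendsto_finsetSum _ fun z' _ => ?_
  by_cases h0 : S.trans z z' = 0
  · simpa [h0] using tendsto_const_nhds
  refine ENNReal.Tendsto.const_mul ?_ (Or.inr ENNReal.ofReal_ne_top)
  refine tendsto_lintegral_filter_of_dominated_convergence (fun e => S.discRet z z' e *
        (marginalUtilityExt (S.gam z'.1) (S.inc z z' e) + ENNReal.ofReal (b z')))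
    (Eventually.of_forall fun t => ?_) ?_ ?_ (Eventually.of_forall fun e => ?_)
  · refine (S.measurable_discRet z z').mul (S.measurable_marginalUtilityExt_comp z' ?_)
    exact (hc.continuous z').measurable.comp
      (((S.ret_measurable z z').mul_const t).add (S.inc_measurable z z'))
  · filter_upwards [self_mem_nhdsWithin] with t ht
    exact Eventually.of_forall fun e =>
      mul_le_mul_right (hc.marginalUtilityExt_le ht z z' e) _
  -- The integral of the dominating function, weighted by a positive transition probability, is one
  -- term of the finite sum `b z`.
  · intro htop
    have h1 : S.condExp z _ < ⊤ := (hb z) ▸ ENNReal.ofReal_lt_top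
    have h2 := ENNReal.sum_lt_top.1 h1 z' (Finset.mem_univ _)
    rw [htop, ENNReal.mul_top] at h2
    · exact h2.ne rfl
    · exact (ENNReal.ofReal_pos.2 (lt_of_le_of_ne (S.trans_nonneg z z') (Ne.symm h0))).ne'
  · refine ENNReal.Tendsto.const_mul ?_ (Or.inr (S.discRet_ne_top _ _ _))
    have hcont : Continuous fun t => marginalUtilityExt (S.gam z'.1)
        (c (S.ret z z' e * t + S.inc z z' e) z') :=
      (continuous_marginalUtilityExt (S.gam_pos _)).comp
        ((hc.continuous z').comp (by fun_prop))
    exact (hcont.tendsto s).mono_left nhdsWithin_le_nhds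

/-- Intermediate value theorem on `[0, w]`: at `ξ = w` the right side is at least `u'(w)`, and at `ξ
= 0` the left side is infinite. The bound `b` keeps the right side finite, which excludes the root
`ξ = 0`. -/
theorem exists_isTimeIterate (hc : S.Admissible b i a c) (hb : S.IsMarginalBound b) {w : ℝ}
    (hw : 0 < w) (z : Fin N × Fin M) : ∃ ξ, S.IsTimeIterate c w z ξ := by
  have hmu := continuous_marginalUtilityExt (S.gam_pos z.1)
  have hcont : ContinuousOn (fun ξ => max (S.eulerTerm c z (w - ξ))
      (marginalUtilityExt (S.gam z.1) w)) (Set.Icc 0 w) := by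
    refine ContinuousOn.sup ?_ continuousOn_const
    exact (hc.continuousOn_eulerTerm hb z).comp (by fun_prop) fun ξ hξ => sub_nonneg.2 hξ.2
  obtain ⟨ξ, hξ, heq⟩ := isPreconnected_Icc.intermediate_value₂ (Set.right_mem_Icc.2 hw.le)
    (Set.left_mem_Icc.2 hw.le) hmu.continuousOn hcont (le_max_right _ _)
    (by rw [marginalUtilityExt_of_nonpos le_rfl]; exact le_top)
  refine ⟨ξ, ?_, hξ.2, heq⟩
  rw [← marginalUtilityExt_lt_top_iff (g := S.gam z.1), heq]
  exact max_lt ((hc.eulerTerm_le hb (sub_nonneg.2 hξ.2) z).trans_lt ENNReal.ofReal_lt_top)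
    (marginalUtilityExt_lt_top_iff.2 hw)

end Admissible

end SavingsModel

/-! ### The absorbing state and invariance of the rays -/

theorem Real.le_rpow_inv_mul_iff {g q x y : ℝ} (hg : 0 < g) (hq : 0 ≤ q) (hx : 0 < x)
    (hy : 0 < y) : y ≤ q ^ (1 / g) * x ↔ x ^ (-g) ≤ q * y ^ (-g) := by
  rw [← Real.rpow_le_rpow_iff hy.le (by positivity) hg, Real.mul_rpow (by positivity) hx.le,
    ← Real.rpow_mul hq, one_div_mul_cancel hg.ne', Real.rpow_one, Real.rpow_neg hx.le,
    Real.rpow_neg hy.le, ← div_eq_mul_inv, le_div_iff₀ (by positivity), inv_mul_eq_div,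
    div_le_iff₀ (by positivity)]

theorem Real.rpow_inv_mul_le_iff {g q x y : ℝ} (hg : 0 < g) (hq : 0 ≤ q) (hx : 0 < x)
    (hy : 0 < y) : q ^ (1 / g) * x ≤ y ↔ q * y ^ (-g) ≤ x ^ (-g) := by
  rw [← Real.rpow_le_rpow_iff (by positivity) hy.le hg, Real.mul_rpow (by positivity) hx.le,
    ← Real.rpow_mul hq, one_div_mul_cancel hg.ne', Real.rpow_one, Real.rpow_neg hx.le,
    Real.rpow_neg hy.le, ← div_eq_mul_inv, div_le_iff₀ (by positivity), inv_mul_eq_div,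
    le_div_iff₀ (by positivity)]

namespace SavingsModel

variable {N M : ℕ} {E : Type*} [MeasurableSpace E] (S : SavingsModel N M E)

theorem Pbar_eq_zero_of_absorbing {i i' : Fin N} (hii : S.Pbar i i = 1) (h : i' ≠ i) :
    S.Pbar i i' = 0 := by
  have h1 := Matrix.sum_row_of_mem_rowStochastic S.Pbar_stochastic i
  rw [← Finset.add_sum_erase _ _ (Finset.mem_univ i), hii, add_eq_left,
    Finset.sum_eq_zero_iff_of_nonneg fun j _ => S.Pbar_stochastic.1 i j] at h1
  exact h1 i' (Finset.mem_erase.2 ⟨h, Finset.mem_univ _⟩)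

theorem condExp_of_absorbing {i : Fin N} (hii : S.Pbar i i = 1) (j : Fin M)
    (f : Fin N × Fin M → E → ℝ≥0∞) :
    S.condExp (i, j) f = ∑ k, ENNReal.ofReal (S.Ptilde j k) * ∫⁻ e, f (i, k) e ∂S.innov := by
  unfold condExp
  rw [Fintype.sum_prod_type, Finset.sum_eq_single_of_mem i (Finset.mem_univ i)]
  · simp [trans, hii]
  · intro i' _ hi'
    simp [trans, S.Pbar_eq_zero_of_absorbing hii hi']

theorem GExt_of_absorbing {i : Fin N} (hii : S.Pbar i i = 1) (j k : Fin M) :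
    S.GExt i j k = ENNReal.ofReal (S.Ptilde j k) *
      ∫⁻ e, S.discRet (i, j) (i, k) e *
        marginalUtilityExt (S.gam i) (S.ret (i, j) (i, k) e) ∂S.innov := by
  rw [GExt, hii, ENNReal.ofReal_one, one_mul, QExt]
  congr 2
  funext e
  split_ifs with h
  · simp [discRet, h]
  · have hR : 0 < S.ret (i, j) (i, k) e := lt_of_le_of_ne (S.ret_nonneg _ _ _) (Ne.symm h)
    rw [discRet, marginalUtilityExt_of_pos hR, ← ENNReal.ofReal_mul
      (mul_nonneg (S.disc_nonneg _ _ _) hR.le), mul_assoc, sub_eq_add_neg, Real.rpow_add hR,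
      Real.rpow_one]

theorem G_nonneg (i : Fin N) (j k : Fin M) : 0 ≤ S.G i j k := ENNReal.toReal_nonneg

theorem rpow_inv_of_F_eq {i : Fin N} {x : Fin M → ℝ} (hx : ∀ k, 0 ≤ x k) (hFx : S.F i x = x)
    (j : Fin M) : x j ^ (1 / S.gam i) = 1 + (S.G i).mulVec x j ^ (1 / S.gam i) := by
  have h0 := Matrix.mulVec_apply_nonneg (S.G_nonneg i) hx j
  conv_lhs => rw [← hFx]
  rw [F, ← Real.rpow_mul (by positivity), mul_one_div_cancel (S.gam_pos i).ne', Real.rpow_one]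

/-- A policy above the rays of slopes `a` gives a power bound on the Euler term. -/
theorem eulerTerm_le_of_linear_le {i : Fin N} (hii : S.Pbar i i = 1)
    (hGfin : ∀ j k, S.GExt i j k < ⊤) {c : ℝ → Fin N × Fin M → ℝ} {x : Fin M → ℝ}
    (hx : ∀ k, 0 < x k) (hc : ∀ w k, 0 ≤ w → x k ^ (-(1 / S.gam i)) * w ≤ c w (i, k))
    (j : Fin M) {s : ℝ} (hs : 0 ≤ s) :
    S.eulerTerm c (i, j) s ≤
      ENNReal.ofReal ((S.G i).mulVec x j) * marginalUtilityExt (S.gam i) s := by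
  have hg := S.gam_pos i
  rw [G, ENNReal.ofReal_mulVec_map_toReal hGfin (fun k => (hx k).le), eulerTerm,
    S.condExp_of_absorbing hii, Finset.sum_mul]
  refine Finset.sum_le_sum fun k _ => ?_
  have hxk : 0 < x k ^ (-(1 / S.gam i)) := Real.rpow_pos_of_pos (hx k) _
  -- The slope is chosen so that its marginal utility is exactly `x k`. Once income is dropped,
  -- `u'(R a s) = u'(R) u'(a) u'(s)` produces the entries of `G`, the vector `x` and the factor
  -- `u'(s)`.
  have hmux : marginalUtilityExt (S.gam i) (x k ^ (-(1 / S.gam i))) = ENNReal.ofReal (x k) := by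
    rw [marginalUtilityExt_of_pos hxk, ← Real.rpow_mul (hx k).le, neg_mul_neg,
      one_div_mul_cancel hg.ne', Real.rpow_one]
  rw [S.GExt_of_absorbing hii, mul_assoc, mul_assoc, ← hmux, ← lintegral_mul_const]
  · refine mul_le_mul_right (lintegral_mono fun e => ?_) _
    dsimp only
    rw [mul_assoc, ← mul_assoc (marginalUtilityExt _ _),
      ← marginalUtilityExt_mul hg (S.ret_nonneg _ _ _),
      ← marginalUtilityExt_mul hg (mul_nonneg (S.ret_nonneg _ _ _) hxk.le)]
    refine mul_le_mul_right (antitone_marginalUtilityExt hg ?_) _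
    have hRs := mul_nonneg (S.ret_nonneg (i, j) (i, k) e) hs
    have hY := S.inc_nonneg (i, j) (i, k) e
    refine le_trans ?_ (hc _ k (add_nonneg hRs hY))
    nlinarith
  · exact (S.measurable_discRet _ _).mul
      (S.measurable_marginalUtilityExt_comp (i, k) (S.ret_measurable _ _))

variable {S} in
-- Where the constraint does not bind, the Euler bound gives `w - ξ ≤ (G x) ^ (1 / γ) ξ`. Adding `ξ`
-- and using `F x = x` yields `w ≤ x ^ (1 / γ) ξ`. Where it binds, `ξ = w` and the slope is at most
-- 1.
theorem IsTimeIterate.linear_le {i : Fin N} (hii : S.Pbar i i = 1)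
    (hGfin : ∀ j k, S.GExt i j k < ⊤) {c : ℝ → Fin N × Fin M → ℝ} {x : Fin M → ℝ}
    (hx : ∀ k, 1 ≤ x k) (hFx : S.F i x = x)
    (hc : ∀ w k, 0 ≤ w → x k ^ (-(1 / S.gam i)) * w ≤ c w (i, k))
    {w ξ : ℝ} {j : Fin M} (h : S.IsTimeIterate c w (i, j) ξ) :
    x j ^ (-(1 / S.gam i)) * w ≤ ξ := by
  have hg := S.gam_pos i
  have hx0 : ∀ k, 0 < x k := fun k => zero_lt_one.trans_le (hx k)
  have hw : 0 < w := h.1.trans_le h.2.1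
  rcases h.2.1.eq_or_lt with rfl | hlt
  · exact mul_le_of_le_one_left hw.le
      (Real.rpow_le_one_of_one_le_of_nonpos (hx j) (by simpa using hg.le))
  have hs : 0 < w - ξ := sub_pos.2 hlt
  have hG0 := Matrix.mulVec_apply_nonneg (S.G_nonneg i) (fun k => (hx0 k).le) j
  have h1 : ξ ^ (-S.gam i) ≤ (S.G i).mulVec x j * (w - ξ) ^ (-S.gam i) := by
    have := (h.eq_eulerTerm hlt).trans_le (S.eulerTerm_le_of_linear_le hii hGfin hx0 hc j hs.le)
    rwa [marginalUtilityExt_of_pos h.1, marginalUtilityExt_of_pos hs, ← ENNReal.ofReal_mul hG0,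
      ENNReal.ofReal_le_ofReal_iff (by positivity)] at this
  have h2 := (Real.le_rpow_inv_mul_iff hg hG0 h.1 hs).2 h1
  have h3 := S.rpow_inv_of_F_eq (fun k => (hx0 k).le) hFx j
  rw [Real.rpow_neg (hx0 j).le, inv_mul_le_iff₀ (Real.rpow_pos_of_pos (hx0 j) _), h3]
  linarith

/-! ### Existence of an optimal policy by a monotone fixed point -/

/-- The time iteration operator. -/
noncomputable def timeIter (c : ℝ → Fin N × Fin M → ℝ) (w : ℝ) (z : Fin N × Fin M) : ℝ :=
  if 0 < w then Classical.epsilon (S.IsTimeIterate c w z) else 0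

namespace Admissible

variable {S} {b : Fin N × Fin M → ℝ} {i : Fin N} {a : Fin M → ℝ} {c : ℝ → Fin N × Fin M → ℝ}

theorem isTimeIterate_timeIter (hc : S.Admissible b i a c) (hb : S.IsMarginalBound b) {w : ℝ}
    (hw : 0 < w) (z : Fin N × Fin M) : S.IsTimeIterate c w z (S.timeIter c w z) := by
  rw [timeIter, if_pos hw]
  exact Classical.epsilon_spec (hc.exists_isTimeIterate hb hw z)

theorem timeIter_of_nonpos {w : ℝ} (hw : w ≤ 0) (z : Fin N × Fin M) : S.timeIter c w z = 0 :=
  if_neg (not_lt.2 hw)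

theorem timeIter_le_timeIter {d : ℝ → Fin N × Fin M → ℝ} (hc : S.Admissible b i a c)
    (hd : S.Admissible b i a d) (hb : S.IsMarginalBound b) (hdc : ∀ w z, d w z ≤ c w z) (w : ℝ)
    (z : Fin N × Fin M) : S.timeIter d w z ≤ S.timeIter c w z := by
  rcases le_or_gt w 0 with hw | hw
  · rw [timeIter_of_nonpos hw, timeIter_of_nonpos hw]
  · exact (hd.isTimeIterate_timeIter hb hw z).le_of_le hc.monotone hdc le_rfl
      (hc.isTimeIterate_timeIter hb hw z)

theorem timeIter (hc : S.Admissible b i a c) (hb : S.IsMarginalBound b)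
    (hlow : ∀ w j ξ, S.IsTimeIterate c w (i, j) ξ → a j * w ≤ ξ) :
    S.Admissible b i a (S.timeIter c) := by
  have hnonneg : ∀ w z, 0 ≤ S.timeIter c w z := fun w z => by
    rcases le_or_gt w 0 with hw | hw
    · rw [timeIter_of_nonpos hw]
    · exact (hc.isTimeIterate_timeIter hb hw z).1.le
  have hle : ∀ w z, S.timeIter c w z ≤ max w 0 := fun w z => by
    rcases le_or_gt w 0 with hw | hw
    · rw [timeIter_of_nonpos hw]; exact le_max_right _ _
    · exact (hc.isTimeIterate_timeIter hb hw z).2.1.trans (le_max_left _ _)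
  refine ⟨hnonneg, hle, fun z v w hvw => ?_, fun z v w hvw => ?_, fun w z => ?_, fun w j hw => ?_⟩
  · dsimp only
    rcases le_or_gt v 0 with hv | hv
    · rw [timeIter_of_nonpos hv]; exact hnonneg w z
    · exact (hc.isTimeIterate_timeIter hb hv z).le_of_le hc.monotone (fun _ _ => le_rfl) hvw
        (hc.isTimeIterate_timeIter hb (hv.trans_le hvw) z)
  · dsimp only
    rcases le_or_gt v 0 with hv | hv
    · have h1 := hle w z
      rw [timeIter_of_nonpos hv, sub_zero]
      rcases le_or_gt w 0 with hw | hw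
      · rwa [timeIter_of_nonpos hw, sub_zero]
      · rw [max_eq_left hw.le] at h1
        linarith
    · exact (hc.isTimeIterate_timeIter hb hv z).sub_le_sub hc.monotone hvw
        (hc.isTimeIterate_timeIter hb (hv.trans_le hvw) z)
  · rcases le_or_gt w 0 with hw | hw
    · rw [marginalUtilityExt_of_nonpos hw, top_add]; exact le_top
    · have h := hc.isTimeIterate_timeIter hb hw z
      rw [h.eq]
      exact max_le ((hc.eulerTerm_le hb (sub_nonneg.2 h.2.1) z).trans le_add_self) le_self_add
  · rcases hw.eq_or_lt with rfl | hw
    · rw [mul_zero]; exact hnonneg 0 _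
    · exact hlow w j _ (hc.isTimeIterate_timeIter hb hw _)

theorem max_zero (ha : ∀ j, a j ≤ 1) : S.Admissible b i a fun w _ => max w 0 := by
  refine ⟨fun w _ => le_max_right _ _, fun w _ => le_rfl, fun _ v w h => max_le_max_right _ h,
    fun _ v w h => ?_, fun w z => ?_, fun w j hw => ?_⟩
  · rcases le_total v 0 with hv | hv <;> rcases le_total w 0 with hw | hw <;>
      simp only [max_eq_left, max_eq_right, hv, hw] <;> linarith
  · exact (antitone_marginalUtilityExt (S.gam_pos _) (le_max_left w 0)).trans le_self_add
  · exact (mul_le_of_le_one_left hw (ha j)).trans (le_max_left _ _)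

/-- Every defining condition is a one-sided or Lipschitz bound, hence stable under pointwise infima.
The bound on marginal utility passes to the infimum because it is a closed condition on consumption.
-/
theorem iInf {U : Set (ℝ → Fin N × Fin M → ℝ)} (hU : U.Nonempty)
    (h : ∀ d ∈ U, S.Admissible b i a d) :
    S.Admissible b i a fun w z => ⨅ d : U, d.1 w z := by
  have : Nonempty U := hU.to_subtype
  obtain ⟨d₀, hd₀⟩ := hU
  have hbdd : ∀ w z, BddBelow (Set.range fun d : U => d.1 w z) := fun w z =>
    ⟨0, by rintro _ ⟨d, rfl⟩; exact (h d.1 d.2).nonneg w z⟩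
  refine ⟨fun w z => le_ciInf fun d => (h d.1 d.2).nonneg w z,
    fun w z => (ciInf_le (hbdd w z) ⟨d₀, hd₀⟩).trans ((h d₀ hd₀).le_max w z),
    fun z v w hvw => ciInf_mono (hbdd v z) fun d => (h d.1 d.2).monotone z hvw,
    fun z v w hvw => ?_, fun w z => ?_, fun w j hw => le_ciInf fun d => (h d.1 d.2).lower w j hw⟩
  · have : (⨅ d : U, d.1 w z) - (w - v) ≤ ⨅ d : U, d.1 v z := le_ciInf fun d => by
      have h1 := (h d.1 d.2).monotone_sub z hvw
      have h2 := ciInf_le (hbdd w z) d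
      dsimp only at h1 h2
      linarith
    dsimp only
    linarith
  · have hclosed : IsClosed {y : ℝ | marginalUtilityExt (S.gam z.1) y ≤
        marginalUtilityExt (S.gam z.1) w + ENNReal.ofReal (b z)} :=
      isClosed_le (continuous_marginalUtilityExt (S.gam_pos _)) continuous_const
    refine closure_minimal ?_ hclosed (csInf_mem_closure (Set.range_nonempty _) (hbdd w z))
    rintro _ ⟨d, rfl⟩
    exact (h d.1 d.2).bound w z

/-- The least admissible policy lying above its time iterate is a fixed point. -/
theorem exists_fixed_point (hb : S.IsMarginalBound b) (ha : ∀ j, a j ≤ 1)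
    (hlow : ∀ c, S.Admissible b i a c → ∀ w j ξ, S.IsTimeIterate c w (i, j) ξ → a j * w ≤ ξ) :
    ∃ c, S.Admissible b i a c ∧ ∀ w z, 0 < w → S.IsTimeIterate c w z (c w z) := by
  let U : Set (ℝ → Fin N × Fin M → ℝ) :=
    {d | S.Admissible b i a d ∧ ∀ w z, S.timeIter d w z ≤ d w z}
  have hU : U.Nonempty := by
    refine ⟨fun w _ => max w 0, max_zero ha, fun w z => ?_⟩
    exact ((max_zero ha).timeIter hb (hlow _ (max_zero ha))).le_max w z
  set c : ℝ → Fin N × Fin M → ℝ := fun w z => ⨅ d : U, d.1 w z with hcdef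
  have : Nonempty U := hU.to_subtype
  have hc : S.Admissible b i a c := iInf hU fun d hd => hd.1
  have hcle : ∀ d ∈ U, ∀ w z, c w z ≤ d w z := fun d hd w z =>
    ciInf_le (f := fun d : U => d.1 w z)
      ⟨0, by rintro _ ⟨d, rfl⟩; exact d.2.1.nonneg w z⟩ ⟨d, hd⟩
  have hTle : ∀ w z, S.timeIter c w z ≤ c w z := fun w z => le_ciInf fun d =>
    (d.2.1.timeIter_le_timeIter hc hb (hcle d.1 d.2) w z).trans (d.2.2 w z)
  have hTc := hc.timeIter hb (hlow c hc)
  -- The time iterate of `c` again belongs to `U`, so minimality of `c` gives the reverse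
  -- inequality.
  have heq : ∀ w z, S.timeIter c w z = c w z := fun w z => le_antisymm (hTle w z)
    (hcle _ ⟨hTc, hc.timeIter_le_timeIter hTc hb hTle⟩ w z)
  refine ⟨c, hc, fun w z hw => ?_⟩
  rw [← heq w z]
  exact hc.isTimeIterate_timeIter hb hw z

theorem isCandidate (hc : S.Admissible b i a c) (hb0 : ∀ z, 0 ≤ b z) : S.IsCandidate c := by
  refine ⟨fun z => (hc.continuous z).continuousOn, fun z => (hc.monotone z).monotoneOn _,
    fun w z hw => hc.pos hw z, fun w z hw => hc.le_self hw.le z, ∑ z, b z, fun w z hw => ?_⟩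
  have h1 := hc.bound w z
  have h2 := antitone_marginalUtilityExt (S.gam_pos z.1) (hc.le_self hw.le z)
  have hwp := Real.rpow_nonneg hw.le (-S.gam z.1)
  rw [marginalUtilityExt_of_pos (hc.pos hw z), marginalUtilityExt_of_pos hw] at h1 h2
  rw [ENNReal.ofReal_le_ofReal_iff (Real.rpow_nonneg (hc.nonneg w z) _)] at h2
  rw [← ENNReal.ofReal_add hwp (hb0 z), ENNReal.ofReal_le_ofReal_iff
    (add_nonneg hwp (hb0 z))] at h1
  rw [marginalUtility_eq_rpow, marginalUtility_eq_rpow, abs_of_nonneg (sub_nonneg.2 h2)]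
  have := Finset.single_le_sum (f := b) (fun z _ => hb0 z) (Finset.mem_univ z)
  linarith

end Admissible

end SavingsModel

/-! ### Uniqueness of the optimal policy -/

namespace SavingsModel

variable {N M : ℕ} {E : Type*} [MeasurableSpace E] {S : SavingsModel N M E}

/-- Contraction estimate for the marginal utilities of two optimal policies. -/
theorem IsOptimalConsumption.sub_le_mulVec (hS : S.StandingAssumptions)
    {c d : ℝ → Fin N × Fin M → ℝ} (hc : S.IsOptimalConsumption c) (hd : S.IsOptimalConsumption d)
    {ρ : Fin N × Fin M → ℝ} (hρ0 : ∀ z, 0 ≤ ρ z)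
    (hρ : ∀ w z, 0 < w → c w z ^ (-S.gam z.1) - d w z ^ (-S.gam z.1) ≤ ρ z)
    {w : ℝ} (hw : 0 < w) (z : Fin N × Fin M) :
    c w z ^ (-S.gam z.1) - d w z ^ (-S.gam z.1) ≤ (S.KExt.map ENNReal.toReal).mulVec ρ z := by
  have hc' := hc.2 w z hw
  have hd' := hd.2 w z hw
  have hK0 : 0 ≤ (S.KExt.map ENNReal.toReal).mulVec ρ z :=
    Matrix.mulVec_apply_nonneg (A := S.KExt.map ENNReal.toReal)
      (fun _ _ => ENNReal.toReal_nonneg) hρ0 z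
  rcases le_or_gt (d w z) (c w z) with h | h
  · have := Real.rpow_le_rpow_of_nonpos hd'.1 h (neg_nonpos.2 (S.gam_pos z.1).le)
    linarith
  have h1 : S.eulerTerm c z (w - c w z) ≤
      S.eulerTerm d z (w - d w z) + ∑ z', S.KExt z z' * ENNReal.ofReal (ρ z') := by
    rw [eulerTerm, eulerTerm, ← condExp_add_discRet_mul]
    refine S.condExp_mono_ae fun z' hz' => ?_
    -- Positive income makes next-period wealth positive, the only range in which `hρ` compares the
    -- policies.
    filter_upwards [hS.ae_inc_pos hz'] with e he
    rw [← mul_add]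
    refine mul_le_mul_right ?_ _
    have hR := S.ret_nonneg z z' e
    have hv : 0 < S.ret z z' e * (w - d w z) + S.inc z z' e := by
      have := mul_nonneg hR (sub_nonneg.2 hd'.2.1)
      linarith
    have hvu : S.ret z z' e * (w - d w z) + S.inc z z' e ≤
        S.ret z z' e * (w - c w z) + S.inc z z' e := by
      have := mul_le_mul_of_nonneg_left (show w - d w z ≤ w - c w z by linarith) hR
      linarith
    -- Here `c < d` today, so `c` saves more and leads to more wealth. Evaluating `c` at the smaller
    -- wealth left by `d` only raises marginal utility, and both policies are then compared at the
    -- same point.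
    have h2 := hc.1.monotoneOn z' hv (hv.trans_le hvu) hvu
    refine (antitone_marginalUtilityExt (S.gam_pos _) h2).trans ?_
    dsimp only
    have hdv := hd.1.pos _ z' hv
    rw [marginalUtilityExt_of_pos (hc.1.pos _ z' hv), marginalUtilityExt_of_pos hdv,
      ← ENNReal.ofReal_add (Real.rpow_nonneg hdv.le _) (hρ0 z')]
    refine ENNReal.ofReal_le_ofReal ?_
    linarith [hρ _ z' hv]
  have h2 := (hc'.eq_eulerTerm (h.trans_le hd'.2.1)).trans_le
    (h1.trans (add_le_add_left hd'.eulerTerm_le _))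
  have hdp := Real.rpow_nonneg hd'.1.le (-S.gam z.1)
  rw [← ENNReal.ofReal_mulVec_map_toReal hS.K_finite hρ0, marginalUtilityExt_of_pos hc'.1,
    marginalUtilityExt_of_pos hd'.1, ← ENNReal.ofReal_add hdp hK0,
    ENNReal.ofReal_le_ofReal_iff (add_nonneg hdp hK0)] at h2
  linarith

/-- The gap `ρ z`, a supremum over wealth, is finite because both marginal utilities stay within
bounded distance of `u'(w)`. The contraction estimate in both directions gives `ρ ≤ K(1) ρ`, which
forces `ρ = 0`. -/
theorem IsOptimalConsumption.unique (hS : S.StandingAssumptions)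
    {c d : ℝ → Fin N × Fin M → ℝ} (hc : S.IsOptimalConsumption c) (hd : S.IsOptimalConsumption d)
    {w : ℝ} (hw : 0 < w) (z : Fin N × Fin M) : c w z = d w z := by
  obtain ⟨B, hB⟩ := hc.1.bounded
  obtain ⟨B', hB'⟩ := hd.1.bounded
  let D : ℝ → Fin N × Fin M → ℝ := fun w z => |c w z ^ (-S.gam z.1) - d w z ^ (-S.gam z.1)|
  let ρ : Fin N × Fin M → ℝ := fun z => ⨆ w : Set.Ioi (0 : ℝ), D w z
  have : Nonempty (Set.Ioi (0 : ℝ)) := ⟨⟨w, hw⟩⟩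
  have hbdd : ∀ z, BddAbove (Set.range fun w : Set.Ioi (0 : ℝ) => D w z) := by
    refine fun z => ⟨B + B', ?_⟩
    rintro _ ⟨v, rfl⟩
    have h1 := abs_le.1 (hB v z v.2)
    have h2 := abs_le.1 (hB' v z v.2)
    simp only [marginalUtility_eq_rpow] at h1 h2
    exact abs_le.2 ⟨by linarith [h1.1, h2.2], by linarith [h1.2, h2.1]⟩
  have hDρ : ∀ w z, 0 < w → D w z ≤ ρ z := fun w z hw =>
    le_ciSup (f := fun w : Set.Ioi (0 : ℝ) => D w z) (hbdd z) ⟨w, hw⟩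
  have hρ0 : ∀ z, 0 ≤ ρ z := fun z => (abs_nonneg _).trans (hDρ w z hw)
  have hρK : ∀ z, ρ z ≤ (S.KExt.map ENNReal.toReal).mulVec ρ z := fun z => ciSup_le fun v => by
    have h1 := hc.sub_le_mulVec hS hd hρ0
      (fun w z hw => (le_abs_self _).trans (hDρ w z hw)) v.2 z
    have h2 := hd.sub_le_mulVec hS hc hρ0
      (fun w z hw => (le_abs_self _).trans ((abs_sub_comm _ _).trans_le (hDρ w z hw))) v.2 z
    exact abs_le.2 ⟨by linarith, h1⟩
  have hzero : D w z = 0 := le_antisymm ((hDρ w z hw).trans (nonpos_of_le_mulVec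
    (A := S.KExt.map ENNReal.toReal) (fun _ _ => ENNReal.toReal_nonneg) hS.K_radius hρK z))
    (abs_nonneg _)
  exact Real.rpow_left_injOn (neg_ne_zero.2 (S.gam_pos z.1).ne') (hc.1.pos w z hw).le
    (hd.1.pos w z hw).le (sub_eq_zero.1 (abs_eq_zero.1 hzero))

end SavingsModel

/-! ### Asymptotics of the optimal policy at large wealth -/

namespace SavingsModel

variable {N M : ℕ} {E : Type*} [MeasurableSpace E] (S : SavingsModel N M E)

/-- The Euler term of the affine policies of slopes `a` and intercept `v`, rescaled by savings
`1 / t`. -/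
noncomputable def affineEulerTerm (i : Fin N) (a : Fin M → ℝ) (v : ℝ) (j : Fin M) (t : ℝ) :
    ℝ≥0∞ :=
  ∑ k, ENNReal.ofReal (S.Ptilde j k) * ∫⁻ e, S.discRet (i, j) (i, k) e *
    marginalUtilityExt (S.gam i)
      (a k * (S.ret (i, j) (i, k) e + t * S.inc (i, j) (i, k) e) + t * v) ∂S.innov

theorem affineEulerTerm_le (i : Fin N) {a : Fin M → ℝ} (ha : ∀ k, 0 ≤ a k) {v : ℝ} (hv : 0 ≤ v)
    (j : Fin M) {t t' : ℝ} (h : t ≤ t') :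
    S.affineEulerTerm i a v j t' ≤ S.affineEulerTerm i a v j t := by
  refine Finset.sum_le_sum fun k _ => mul_le_mul_right (lintegral_mono fun e =>
    mul_le_mul_right (antitone_marginalUtilityExt (S.gam_pos i) ?_) _) _
  have hY := S.inc_nonneg (i, j) (i, k) e
  have := ha k
  gcongr

/-- As `t` decreases to 0 the integrands increase, so monotone convergence applies and no integrable
majorant is needed. -/
theorem tendsto_affineEulerTerm {i : Fin N} (hii : S.Pbar i i = 1) {a : Fin M → ℝ}
    (ha : ∀ k, 0 ≤ a k) {v : ℝ} (hv : 0 ≤ v) (j : Fin M) :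
    Tendsto (fun n : ℕ => S.affineEulerTerm i a v j (1 / ((n : ℝ) + 1))) atTop
      (𝓝 (∑ k, S.GExt i j k * marginalUtilityExt (S.gam i) (a k))) := by
  have hg := S.gam_pos i
  refine tendsto_finsetSum _ fun k _ => ?_
  have hmeas : Measurable fun e => S.discRet (i, j) (i, k) e *
      marginalUtilityExt (S.gam i) (S.ret (i, j) (i, k) e) :=
    (S.measurable_discRet _ _).mul
      (S.measurable_marginalUtilityExt_comp (i, k) (S.ret_measurable _ _))
  rw [S.GExt_of_absorbing hii, mul_assoc, ← lintegral_mul_const _ hmeas]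
  refine ENNReal.Tendsto.const_mul ?_ (Or.inr ENNReal.ofReal_ne_top)
  refine lintegral_tendsto_of_tendsto_of_monotone (fun n => ?_)
    (Eventually.of_forall fun e => ?_) (Eventually.of_forall fun e => ?_)
  · refine ((S.measurable_discRet _ _).mul
      (S.measurable_marginalUtilityExt_comp (i, k) ?_)).aemeasurable
    exact (((S.ret_measurable _ _).add ((S.inc_measurable _ _).const_mul _)).const_mul _).add_const _
  · intro m n hmn
    refine mul_le_mul_right (antitone_marginalUtilityExt hg ?_) _
    have hY := S.inc_nonneg (i, j) (i, k) e
    have := ha k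
    gcongr
  · rw [mul_assoc, ← marginalUtilityExt_mul hg (S.ret_nonneg _ _ _)]
    refine ENNReal.Tendsto.const_mul ?_ (Or.inr (S.discRet_ne_top _ _ _))
    have hcont : Continuous fun t : ℝ => marginalUtilityExt (S.gam i)
        (a k * (S.ret (i, j) (i, k) e + t * S.inc (i, j) (i, k) e) + t * v) :=
      (continuous_marginalUtilityExt hg).comp (by fun_prop)
    have := (hcont.tendsto 0).comp (tendsto_one_div_add_atTop_nhds_zero_nat (𝕜 := ℝ))
    simpa [Function.comp_def, mul_comm (a k)] using this

/-- A policy below affine functions of slopes `a` has an Euler term above the affine one. -/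
theorem le_eulerTerm_of_le_affine {i : Fin N} (hii : S.Pbar i i = 1)
    {c : ℝ → Fin N × Fin M → ℝ} {a : Fin M → ℝ} {v : ℝ}
    (hc : ∀ w k, 0 ≤ w → c w (i, k) ≤ a k * w + v) (j : Fin M) {s : ℝ} (hs : 0 < s) :
    S.affineEulerTerm i a v j (1 / s) * marginalUtilityExt (S.gam i) s ≤
      S.eulerTerm c (i, j) s := by
  have hg := S.gam_pos i
  rw [eulerTerm, S.condExp_of_absorbing hii, affineEulerTerm, Finset.sum_mul]
  refine Finset.sum_le_sum fun k _ => ?_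
  rw [mul_assoc]
  refine mul_le_mul_right ?_ _
  refine (lintegral_mul_const_le _ _).trans (lintegral_mono fun e => ?_)
  dsimp only
  rw [mul_assoc, mul_comm (marginalUtilityExt _ _), ← marginalUtilityExt_mul hg hs.le]
  refine mul_le_mul_right (antitone_marginalUtilityExt hg ?_) _
  have hRs := mul_nonneg (S.ret_nonneg (i, j) (i, k) e) hs.le
  refine (hc _ k (add_nonneg hRs (S.inc_nonneg (i, j) (i, k) e))).trans_eq ?_
  field_simp

variable {S}

/-- One step of the asymptotic Euler equation: lower bounds `A` on the wealth-consumption ratios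
at infinity improve to `1 + (G A ^ γ) ^ (1 / γ)`. -/
theorem Admissible.eventually_le_div {b : Fin N × Fin M → ℝ} {i : Fin N} {a : Fin M → ℝ}
    {c : ℝ → Fin N × Fin M → ℝ} (hc : S.Admissible b i a c)
    (hfix : ∀ w z, 0 < w → S.IsTimeIterate c w z (c w z)) (hii : S.Pbar i i = 1)
    (hGfin : ∀ j k, S.GExt i j k < ⊤) {A : Fin M → ℝ} (hA0 : ∀ k, 0 < A k)
    (hA : ∀ k, ∀ᶠ w in atTop, A k ≤ w / c w (i, k)) {j : Fin M} {B : ℝ}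
    (hB : B < 1 + (S.G i).mulVec (fun k => A k ^ S.gam i) j ^ (1 / S.gam i)) :
    ∀ᶠ w in atTop, B ≤ w / c w (i, j) := by
  have hg := S.gam_pos i
  rcases le_or_gt B 1 with hB1 | hB1
  · filter_upwards [eventually_gt_atTop 0] with w hw
    exact hB1.trans ((one_le_div (hc.pos hw _)).2 (hc.le_self hw.le _))
  have hB0 : 0 < B - 1 := sub_pos.2 hB1
  set q := (S.G i).mulVec (fun k => A k ^ S.gam i) j with hq
  have hq0 : 0 ≤ q := Matrix.mulVec_apply_nonneg (S.G_nonneg i)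
    (fun k => Real.rpow_nonneg (hA0 k).le _) j
  -- The target `w ≥ B c` amounts to `w - c ≥ θ ^ (1 / γ) c`, and the strict gap `θ < q` leaves room
  -- for income and intercepts.
  set θ := (B - 1) ^ S.gam i with hθ
  have hθ0 : 0 < θ := Real.rpow_pos_of_pos hB0 _
  have hθB : θ ^ (1 / S.gam i) = B - 1 := by
    rw [hθ, ← Real.rpow_mul hB0.le, mul_one_div_cancel hg.ne', Real.rpow_one]
  have hθq : θ < q := by
    rw [← Real.rpow_lt_rpow_iff hθ0.le hq0 (one_div_pos.2 hg), hθB]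
    linarith
  obtain ⟨v, hv⟩ := eventually_atTop.1 (eventually_all.2 hA)
  set v' := max v 1 with hv'
  have hv'0 : 0 < v' := lt_max_of_lt_right one_pos
  -- Above `v'` the ratio bound gives the slope; below `v'`, consumption is at most wealth, which
  -- the intercept covers.
  have hcaff : ∀ w k, 0 ≤ w → c w (i, k) ≤ (A k)⁻¹ * w + v' := by
    intro w k hw
    rcases le_or_gt v' w with h | h
    · have h1 := hv w ((le_max_left _ _).trans h) k
      rw [le_div_iff₀ (hc.pos (hv'0.trans_le h) _), ← le_inv_mul_iff₀ (hA0 k)] at h1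
      linarith
    · have := mul_nonneg (inv_nonneg.2 (hA0 k).le) hw
      linarith [hc.le_self hw (i, k)]
  have hAinv : ∀ k, 0 ≤ (A k)⁻¹ := fun k => inv_nonneg.2 (hA0 k).le
  have hlim : ENNReal.ofReal θ <
      ∑ k, S.GExt i j k * marginalUtilityExt (S.gam i) (A k)⁻¹ := by
    have : ∑ k, S.GExt i j k * marginalUtilityExt (S.gam i) (A k)⁻¹ = ENNReal.ofReal q := by
      rw [hq, G, ENNReal.ofReal_mulVec_map_toReal hGfin
        (fun k => Real.rpow_nonneg (hA0 k).le _)]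
      refine Finset.sum_congr rfl fun k _ => ?_
      rw [marginalUtilityExt_of_pos (inv_pos.2 (hA0 k)), Real.inv_rpow (hA0 k).le,
        Real.rpow_neg (hA0 k).le, inv_inv]
    rw [this]
    exact (ENNReal.ofReal_lt_ofReal_iff_of_nonneg hθ0.le).2 hθq
  obtain ⟨n, hn⟩ := ((S.tendsto_affineEulerTerm hii hAinv hv'0.le j).eventually_const_lt
    hlim).exists
  set s₀ : ℝ := (n : ℝ) + 1 with hs₀
  have hs₀0 : 0 < s₀ := by positivity
  have heuler : ∀ s, s₀ ≤ s →
      ENNReal.ofReal (θ * s ^ (-S.gam i)) ≤ S.eulerTerm c (i, j) s := by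
    intro s hs
    have hs0 := hs₀0.trans_le hs
    refine le_trans ?_ (S.le_eulerTerm_of_le_affine hii hcaff j hs0)
    rw [ENNReal.ofReal_mul hθ0.le, ← marginalUtilityExt_of_pos hs0]
    refine mul_le_mul_left (hn.le.trans (S.affineEulerTerm_le i hAinv hv'0.le j ?_)) _
    exact one_div_le_one_div_of_le hs₀0 hs
  -- If savings were below `s₀`, the Euler bound at `s₀` would still force `c ≤ s₀ / (B - 1)`, so
  -- wealth would be less than this threshold.
  filter_upwards [eventually_ge_atTop (s₀ + s₀ / (B - 1)), eventually_gt_atTop 0] with w hw hw0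
  have hcw := hfix w (i, j) hw0
  have hmu := hcw.eulerTerm_le
  rw [marginalUtilityExt_of_pos hcw.1] at hmu
  have hcp := Real.rpow_nonneg hcw.1.le (-S.gam i)
  rw [le_div_iff₀ hcw.1]
  rcases le_or_gt s₀ (w - c w (i, j)) with h | h
  · have h1 := (ENNReal.ofReal_le_ofReal_iff hcp).1 ((heuler _ h).trans hmu)
    have h2 := (Real.rpow_inv_mul_le_iff hg hθ0.le hcw.1 (hs₀0.trans_le h)).2 h1
    rw [hθB] at h2
    linarith
  · have h1 := (ENNReal.ofReal_le_ofReal_iff hcp).1 (((heuler _ le_rfl).trans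
      (S.antitone_eulerTerm hc.monotone (i, j) h.le)).trans hmu)
    have h2 := (Real.rpow_inv_mul_le_iff hg hθ0.le hcw.1 hs₀0).2 h1
    rw [hθB, mul_comm, ← le_div_iff₀ hB0] at h2
    linarith

/-- An optimal policy lying above the rays given by the fixed point of `F i` is asymptotic to
them. -/
theorem Admissible.tendsto_div {b : Fin N × Fin M → ℝ} {i : Fin N} {x : Fin M → ℝ}
    {c : ℝ → Fin N × Fin M → ℝ}
    (hc : S.Admissible b i (fun k => x k ^ (-(1 / S.gam i))) c)
    (hfix : ∀ w z, 0 < w → S.IsTimeIterate c w z (c w z)) (hii : S.Pbar i i = 1)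
    (hGfin : ∀ j k, S.GExt i j k < ⊤) (hx1 : ∀ k, 1 ≤ x k) (hFx : S.F i x = x) (j : Fin M) :
    Tendsto (fun w => c w (i, j) / w) atTop (𝓝 (x j ^ (-(1 / S.gam i)))) := by
  have hg := S.gam_pos i
  have hx0 : ∀ k, 0 < x k := fun k => zero_lt_one.trans_le (hx1 k)
  have hle : ∀ k, ∀ᶠ w in atTop, w / c w (i, k) ≤ x k ^ (1 / S.gam i) := fun k => by
    filter_upwards [eventually_gt_atTop 0] with w hw
    have h := hc.lower w k hw.le
    rw [Real.rpow_neg (hx0 k).le, inv_mul_le_iff₀ (Real.rpow_pos_of_pos (hx0 k) _)] at h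
    exact (div_le_iff₀ (hc.pos hw _)).2 h
  have hge : ∀ k, ∀ᶠ w in atTop, 1 ≤ w / c w (i, k) := fun k => by
    filter_upwards [eventually_gt_atTop 0] with w hw
    exact (one_le_div (hc.pos hw _)).2 (hc.le_self hw.le _)
  have hbelow : ∀ k, IsBoundedUnder (· ≥ ·) atTop fun w => w / c w (i, k) :=
    fun k => ⟨1, hge k⟩
  have habove : ∀ k, IsBoundedUnder (· ≤ ·) atTop fun w => w / c w (i, k) :=
    fun k => ⟨_, hle k⟩
  set ℓ : Fin M → ℝ := fun k => liminf (fun w => w / c w (i, k)) atTop with hℓ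
  have hleℓ : ∀ k B, (∀ᶠ w in atTop, B ≤ w / c w (i, k)) → B ≤ ℓ k := fun k B h =>
    le_liminf_of_le (habove k).isCoboundedUnder_ge h
  have hℓ1 : ∀ k, 1 ≤ ℓ k := fun k => hleℓ k 1 (hge k)
  have hℓ0 : ∀ k, 0 < ℓ k := fun k => zero_lt_one.trans_le (hℓ1 k)
  set Φ : Fin M → ℝ := fun j => (S.G i).mulVec (fun k => ℓ k ^ S.gam i) j ^ (1 / S.gam i) with hΦ
  -- The lower limit `ℓ` need not be an eventual lower bound, but `t ℓ` is for `t < 1`. The map `ℓ ↦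
  -- (G ℓ ^ γ) ^ (1 / γ)` is homogeneous of degree one, so letting `t → 1` recovers the inequality
  -- for `ℓ`.
  have hstep : ∀ t : ℝ, 0 < t → t < 1 → ∀ j, 1 + t * Φ j ≤ ℓ j := by
    intro t ht0 ht1 j
    have hscale : (S.G i).mulVec (fun k => (t * ℓ k) ^ S.gam i) j ^ (1 / S.gam i) = t * Φ j := by
      have h1 : (fun k => (t * ℓ k) ^ S.gam i) = t ^ S.gam i • fun k => ℓ k ^ S.gam i := by
        funext k
        exact Real.mul_rpow ht0.le (hℓ0 k).le
      rw [h1, Matrix.mulVec_smul, Pi.smul_apply, smul_eq_mul, Real.mul_rpow (by positivity)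
        (Matrix.mulVec_apply_nonneg (S.G_nonneg i) (fun k => Real.rpow_nonneg (hℓ0 k).le _) j),
        ← Real.rpow_mul ht0.le, mul_one_div_cancel hg.ne', Real.rpow_one]
    refine le_of_forall_lt fun B hB => ?_
    obtain ⟨B', hBB', hB'⟩ := exists_between hB
    refine hBB'.trans_le (hleℓ j B' (hc.eventually_le_div hfix hii hGfin
      (A := fun k => t * ℓ k) (fun k => mul_pos ht0 (hℓ0 k)) (fun k => ?_)
      (by rwa [hscale])))
    exact (eventually_lt_of_lt_liminf (mul_lt_of_lt_one_left (hℓ0 k) ht1) (hbelow k)).mono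
      fun _ h => h.le
  have hsup : ∀ j, 1 + Φ j ≤ ℓ j := by
    intro j
    have h1 : Tendsto (fun t : ℝ => 1 + t * Φ j) (𝓝[<] 1) (𝓝 (1 + 1 * Φ j)) :=
      ((continuous_const.add (continuous_id.mul continuous_const)).tendsto 1).mono_left
        nhdsWithin_le_nhds
    rw [one_mul] at h1
    refine le_of_tendsto h1 ?_
    filter_upwards [Ioo_mem_nhdsLT (zero_lt_one' ℝ)] with t ht
    exact hstep t ht.1 ht.2 j
  have hcancel : ∀ k, (ℓ k ^ S.gam i) ^ (1 / S.gam i) = ℓ k := fun k => by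
    rw [← Real.rpow_mul (hℓ0 k).le, mul_one_div_cancel hg.ne', Real.rpow_one]
  have hxℓ := le_of_sub_super_solution (S.G_nonneg i) hg (fun k => (hx0 k).le)
    (fun k => Real.rpow_pos_of_pos (hℓ0 k) (S.gam i)) (fun k => (S.rpow_inv_of_F_eq (fun k => (hx0 k).le) hFx k).le)
    (fun k => (hsup k).trans_eq (hcancel k).symm) j
  have hxℓ' : x j ^ (1 / S.gam i) ≤ ℓ j :=
    (Real.rpow_le_rpow (hx0 j).le hxℓ (one_div_pos.2 hg).le).trans_eq (hcancel j)
  have hlim : Tendsto (fun w => w / c w (i, j)) atTop (𝓝 (x j ^ (1 / S.gam i))) :=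
    tendsto_of_le_liminf_of_limsup_le hxℓ'
      (limsup_le_of_le (hbelow j).isCoboundedUnder_le (hle j)) (habove j) (hbelow j)
  rw [Real.rpow_neg (hx0 j).le]
  simpa only [inv_div] using hlim.inv₀ (Real.rpow_pos_of_pos (hx0 j) _).ne'

end SavingsModel

theorem theorem3p3 {N M : ℕ} {E : Type*} [MeasurableSpace E] (S : SavingsModel N M E)
    (hS : S.StandingAssumptions) (i : Fin N) (hii : S.Pbar i i = 1)
    (hGfin : ∀ j k, S.GExt i j k < ⊤) (hGrad : matrixSpectralRadius (S.G i) < 1) :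
    ∃ x : Fin M → ℝ,
      ((∀ j, 1 ≤ x j) ∧ S.F i x = x) ∧
      (∀ y : Fin M → ℝ, (∀ j, 1 ≤ y j) → S.F i y = y → y = x) ∧
      ∃ c : ℝ → Fin N × Fin M → ℝ,
        S.IsOptimalConsumption c ∧
        (∀ c', S.IsOptimalConsumption c' → ∀ w z, 0 < w → c' w z = c w z) ∧
        ∀ j, Tendsto (fun w : ℝ => c w (i, j) / w) atTop (𝓝 (x j ^ (-(1 / S.gam i)))) ∧
          0 < x j ^ (-(1 / S.gam i)) := by
  have hg := S.gam_pos i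
  obtain ⟨x, hx1, hx⟩ := exists_fixed_point_of_spectralRadius_lt_one (S.G_nonneg i) hGrad hg
  have hFx : S.F i x = x := funext hx
  have hle : ∀ y y' : Fin M → ℝ, (∀ j, 1 ≤ y j) → S.F i y = y → (∀ j, 1 ≤ y' j) →
      S.F i y' = y' → ∀ j, y j ≤ y' j := fun y y' hy hFy hy' hFy' =>
    le_of_sub_super_solution (S.G_nonneg i) hg (fun k => zero_le_one.trans (hy k))
      (fun k => zero_lt_one.trans_le (hy' k)) (fun k => (S.rpow_inv_of_F_eq (fun k => zero_le_one.trans (hy k)) hFy k).le)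
      (fun k => (S.rpow_inv_of_F_eq (fun k => zero_le_one.trans (hy' k)) hFy' k).ge)
  obtain ⟨b, hb0, hb⟩ := hS.exists_isMarginalBound
  obtain ⟨c, hc, hfix⟩ := SavingsModel.Admissible.exists_fixed_point (i := i)
    (a := fun k => x k ^ (-(1 / S.gam i))) hb
    (fun k => Real.rpow_le_one_of_one_le_of_nonpos (hx1 k) (by simpa using hg.le))
    (fun c hc w j ξ h => h.linear_le hii hGfin hx1 hFx (fun w k hw => hc.lower w k hw))
  have hopt : S.IsOptimalConsumption c := ⟨hc.isCandidate hb0, hfix⟩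
  exact ⟨x, ⟨hx1, hFx⟩,
    fun y hy hFy => funext fun j =>
      le_antisymm (hle y x hy hFy hx1 hFx j) (hle x y hx1 hFx hy hFy j),
    c, hopt, fun c' hc' w z hw => hc'.unique hS hopt hw z,
    fun j => ⟨hc.tendsto_div hfix hii hGfin hx1 hFx j,
      Real.rpow_pos_of_pos (zero_lt_one.trans_le (hx1 j)) _⟩⟩
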